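/- Let $\nu>0$ and $f\in\mathbb{R}$, and write $(x,y,z)$ for the coordinates of $\mathbb{R}^3$. On the complex Hilbert space $[L^2(\mathbb{R}^3)]^3$ consider the linearized operator $$\mathscr L=(\nu\Delta-y\partial_x)I_3+\begin{pmatrix} f\Delta^{-1}\partial_{xy} & f-1+(2-f)\Delta^{-1}\partial_x^2 & 0\\ -f+f\Delta^{-1}\partial_y^2 & (2-f)\Delta^{-1}\partial_{xy} & 0\\ f\Delta^{-1}\partial_{yz} & (2-f)\Delta^{-1}\partial_{xz} & 0\end{pmatrix}$$ with domain $\mathcal D(\mathscr L)=\{\mathbf u\in[L^2(\mathbb{R}^3)]^3 : \Delta\mathbf u,\ y\partial_x\mathbf u\in[L^2(\mathbb{R}^3)]^3\}$, the derivatives being taken in the sense of distributions; here $\Delta^{-1}\partial_i\partial_j$ is the Fourier multiplier with symbol $\xi_i\xi_j/|\xi|^2$. Then $\mathscr L$ is densely defined and closed, and its spectrum consists entirely of continuous spectrum: for every $\lambda\in\sigma(\mathscr L)$ the operator $\lambda-\mathscr L$ is injective with dense range and is not surjective. Neither $\mathscr L$ nor its Hilbert space adjoint $\mathscr L^{*}$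 has an eigenvalue; in particular, $\mathscr L$ has no exponentially growing eigenfunctions. -/

import Mathlib

open MeasureTheory FourierTransform
open scoped SchwartzMap LineDeriv Laplacian ENNReal

noncomputable section

namespace InertialInstability

/-! ### Spectra of unbounded operators -/

section Spectrum

variable {X : Type*} [NormedAddCommGroup X] [NormedSpace ℂ X]

/-- The linear map `lam - T`, defined on the domain of `T`. -/
def shift (T : X →ₗ.[ℂ] X) (lam : ℂ) : T.domain →ₗ[ℂ] X :=
  lam • T.domain.subtype - T.toFun

/-- `lam` is in the resolvent set of `T` if `lam - T` has an everywhere defined bounded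
two-sided inverse `R` (with values in the domain of `T`). -/
def resolventSet (T : X →ₗ.[ℂ] X) : Set ℂ :=
  {lam | ∃ R : X →L[ℂ] X,
    (∀ x : X, ∃ u : T.domain, (u : X) = R x ∧ shift T lam u = x) ∧
    ∀ u : T.domain, R (shift T lam u) = u}

/-- The spectrum: the complement of the resolvent set. -/
def spectrumOf (T : X →ₗ.[ℂ] X) : Set ℂ := (resolventSet T)ᶜ

/-- The point spectrum: the set of eigenvalues. -/
def pointSpectrum (T : X →ₗ.[ℂ] X) : Set ℂ :=
  {lam | ∃ u : T.domain, u ≠ 0 ∧ T u = lam • (u : X)}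

/-- The continuous spectrum: `lam - T` is injective with dense range, but not onto. -/
def continuousSpectrum (T : X →ₗ.[ℂ] X) : Set ℂ :=
  {lam | Function.Injective (shift T lam) ∧ DenseRange (shift T lam) ∧
    ¬ Function.Surjective (shift T lam)}

end Spectrum

/-! ### Operators on `L²(ℝ³)` -/

/-- Physical space `ℝ³`; the coordinates `(x, y, z)` have the indices `0, 1, 2`. -/
abbrev Space : Type := EuclideanSpace ℝ (Fin 3)

/-- `L²(ℝ³)`, complex valued. -/
abbrev L2 : Type := Lp (α := Space) ℂ 2 volume

/-- `[L²(ℝ³)]³` as a Hilbert space. -/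
abbrev L2Cubed : Type := PiLp 2 (fun _ : Fin 3 => L2)

/-- The embedding of `L²(ℝ³)` into the tempered distributions. -/
def toDistr : L2 →ₗ[ℂ] 𝓢'(Space, ℂ) :=
  (Lp.toTemperedDistributionCLM (E := Space) ℂ volume 2).toLinearMap

theorem toDistr_injective : Function.Injective toDistr :=
  LinearMap.ker_eq_bot.mp Lp.ker_toTemperedDistributionCLM_eq_bot

/-- The maximal realization in `L²(ℝ³)` of an operator `A` on tempered distributions: its domain
consists of the `u ∈ L²` whose distributional image `A u` is in `L²`, and it sends `u` to `A u`. -/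
def realization (A : 𝓢'(Space, ℂ) →L[ℂ] 𝓢'(Space, ℂ)) : L2 →ₗ.[ℂ] L2 where
  domain := (LinearMap.range toDistr).comap (A.toLinearMap ∘ₗ toDistr)
  toFun := (LinearEquiv.ofInjective toDistr toDistr_injective).symm.toLinearMap ∘ₗ
    ((A.toLinearMap ∘ₗ toDistr).restrict fun _ hu => hu)

theorem mem_realization_domain (A : 𝓢'(Space, ℂ) →L[ℂ] 𝓢'(Space, ℂ)) (u : L2) :
    u ∈ (realization A).domain ↔ ∃ w : L2, toDistr w = A (toDistr u) :=
  Iff.rfl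

theorem toDistr_realization (A : 𝓢'(Space, ℂ) →L[ℂ] 𝓢'(Space, ℂ)) (u : (realization A).domain) :
    toDistr (realization A u) = A (toDistr u) :=
  congrArg Subtype.val
    ((LinearEquiv.ofInjective toDistr toDistr_injective).apply_symm_apply
      ⟨A (toDistr u), u.2⟩)

/-- The Laplacian `Δ` in `L²(ℝ³)`, in the sense of distributions. -/
def laplacianL2 : L2 →ₗ.[ℂ] L2 :=
  realization (LineDeriv.laplacianCLM ℂ Space 𝓢'(Space, ℂ))

/-- The transport operator `y ∂ₓ` in `L²(ℝ³)`, in the sense of distributions. -/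
def transportL2 : L2 →ₗ.[ℂ] L2 :=
  realization
    (TemperedDistribution.smulLeftCLM ℂ (fun p : Space => ((p 1 : ℝ) : ℂ)) ∘L
      LineDeriv.lineDerivOpCLM ℂ 𝓢'(Space, ℂ) (EuclideanSpace.single 0 1 : Space))

/-- The coordinate `y` has temperate growth, so that it may multiply tempered distributions. -/
theorem hasTemperateGrowth_y :
    Function.HasTemperateGrowth (fun p : Space => ((p 1 : ℝ) : ℂ)) :=
  (Complex.ofRealCLM ∘L (EuclideanSpace.proj 1 : Space →L[ℝ] ℝ)).hasTemperateGrowth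

/-- The Fourier symbol `ξᵢ ξⱼ / |ξ|²` of `Δ⁻¹ ∂ᵢ ∂ⱼ`. -/
def rieszSymbol (i j : Fin 3) (ξ : Space) : ℂ := ((ξ i * ξ j / ‖ξ‖ ^ 2 : ℝ) : ℂ)

theorem rieszSymbol_memLp (i j : Fin 3) : MemLp (rieszSymbol i j) ∞ (volume : Measure Space) := by
  refine memLp_top_of_bound ?_ 1 (Filter.Eventually.of_forall fun ξ => ?_)
  · have : Measurable (rieszSymbol i j) := by unfold rieszSymbol; fun_prop
    exact this.aestronglyMeasurable
  · have hi : |ξ i| ≤ ‖ξ‖ := PiLp.norm_apply_le ξ i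
    have hj : |ξ j| ≤ ‖ξ‖ := PiLp.norm_apply_le ξ j
    rw [rieszSymbol, Complex.norm_real, Real.norm_eq_abs, abs_div, abs_mul, abs_pow, abs_norm]
    refine div_le_one_of_le₀ ?_ (by positivity)
    rw [pow_two]
    exact mul_le_mul hi hj (abs_nonneg _) (norm_nonneg _)

/-- The bounded operator `Δ⁻¹ ∂ᵢ ∂ⱼ` on `L²(ℝ³)`: the Fourier multiplier
`u ↦ 𝓕⁻¹ ((ξᵢ ξⱼ / |ξ|²) 𝓕 u)`. -/
def riesz (i j : Fin 3) : L2 →L[ℂ] L2 :=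
  (Lp.fourierTransformₗᵢ Space ℂ).symm.toContinuousLinearEquiv.toContinuousLinearMap ∘L
    (ContinuousLinearMap.lsmul ℂ ℂ).holderL volume ∞ 2 2 ((rieszSymbol_memLp i j).toLp _) ∘L
      (Lp.fourierTransformₗᵢ Space ℂ).toContinuousLinearEquiv.toContinuousLinearMap

theorem fourier_riesz (i j : Fin 3) (u : L2) :
    ((𝓕 (riesz i j u) : L2) : Space → ℂ) =ᵐ[volume] fun ξ => rieszSymbol i j ξ * (𝓕 u : L2) ξ := by
  have h : (𝓕 (riesz i j u) : L2) =
      (ContinuousLinearMap.lsmul ℂ ℂ).holder 2 ((rieszSymbol_memLp i j).toLp _) (𝓕 u : L2) :=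
    (Lp.fourierTransformₗᵢ Space ℂ).apply_symm_apply _
  rw [h]
  filter_upwards [(ContinuousLinearMap.lsmul ℂ ℂ).coeFn_holder (r := 2)
    ((rieszSymbol_memLp i j).toLp _) (𝓕 u : L2), (rieszSymbol_memLp i j).coeFn_toLp] with ξ h1 h2
  rw [h1, h2]
  rfl

/-! ### The linearized operator -/

/-- The matrix of bounded operators on `L²(ℝ³)` that collects the shear, Coriolis and pressure
terms. -/
def coupling (f : ℝ) : Matrix (Fin 3) (Fin 3) (L2 →L[ℂ] L2) :=
  let F : ℂ := f
  !![F • riesz 0 1,       (F - 1) • 1 + (2 - F) • riesz 0 0, 0;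
     -F • 1 + F • riesz 1 1, (2 - F) • riesz 0 1,            0;
     F • riesz 1 2,       (2 - F) • riesz 0 2,               0]

/-- The operator linearized at the Couette flow `(y, 0, 0)`, with viscosity `ν` and Coriolis
coefficient `f`, acting in `[L²(ℝ³)]³`: it is `νΔ - y∂ₓ` on each component plus the bounded matrix
`coupling f`, on the domain of the `u` with `Δu, y∂ₓu ∈ [L²(ℝ³)]³`. -/
def linearizedOp (ν f : ℝ) : L2Cubed →ₗ.[ℂ] L2Cubed where
  domain :=
    { carrier := {u | ∀ i, u i ∈ laplacianL2.domain ∧ u i ∈ transportL2.domain}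
      zero_mem' := fun _ => ⟨zero_mem _, zero_mem _⟩
      add_mem' := fun hu hv i =>
        ⟨add_mem (hu i).1 (hv i).1, add_mem (hu i).2 (hv i).2⟩
      smul_mem' := fun c _ hu i =>
        ⟨Submodule.smul_mem _ c (hu i).1, Submodule.smul_mem _ c (hu i).2⟩ }
  toFun :=
    { toFun := fun u => WithLp.toLp 2 fun i =>
        (ν : ℂ) • laplacianL2 ⟨u.1 i, (u.2 i).1⟩ - transportL2 ⟨u.1 i, (u.2 i).2⟩
          + ∑ j, coupling f i j (u.1 j)
      map_add' := fun u v => by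
        refine PiLp.ext fun i => ?_
        have h1 := laplacianL2.map_add ⟨u.1 i, (u.2 i).1⟩ ⟨v.1 i, (v.2 i).1⟩
        have h2 := transportL2.map_add ⟨u.1 i, (u.2 i).2⟩ ⟨v.1 i, (v.2 i).2⟩
        simp only [AddMemClass.mk_add_mk] at h1 h2
        simp only [Submodule.coe_add, PiLp.add_apply, map_add, Finset.sum_add_distrib, h1, h2,
          smul_add]
        abel
      map_smul' := fun c u => by
        refine PiLp.ext fun i => ?_
        have h1 := laplacianL2.map_smul c ⟨u.1 i, (u.2 i).1⟩
        have h2 := transportL2.map_smul c ⟨u.1 i, (u.2 i).2⟩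
        simp only [SetLike.mk_smul_mk] at h1 h2
        simp only [Submodule.coe_smul, PiLp.smul_apply, map_smul, h1, h2, RingHom.id_apply,
          smul_add, smul_sub, Finset.smul_sum]
        rw [smul_comm] }

end InertialInstability

end

noncomputable section

namespace InertialInstability

/-! ### Reduction of the spectral statement to closedness and absence of eigenvalues. -/

section Abstract

/-! For a closed densely defined operator without eigenvalues, whose adjoint has none either, every
spectral point is continuous spectrum: the closed graph theorem turns bijectivity of `λ - T` into
bounded invertibility, and a vector orthogonal to its range is an eigenvector of the adjoint. What
remains is closedness and two uniqueness statements, all handled on the Fourier side.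

There `y∂ₓ` becomes `-D` with `D = ξ₀∂₁`, the generator of the measure-preserving shears `ξ ↦ ξ +
sξ₀e₁`; `νΔ` becomes `-c|ξ|²` with `c = 4π²ν`; and the coupling becomes multiplication by a bounded
matrix. The basic tool is `re_inner_weakShearDeriv_eq_zero`: if `u` and its weak derivative `Du` are
in `L²`, then `Re⟨u, Du⟩ = 0`, with no further regularity assumed.

Closedness. Since `|D|ξ|²| = |2ξ₀ξ₁| ≤ |ξ|²`, skew-symmetry tested with a truncation of `c|ξ|²u`
bounds `c|ξ|²u` by `Du - c|ξ|²u` and `u` (`norm_le_of_hasWeakShearDeriv`). Hence along a sequence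
converging in the graph norm, `Δu` and `y∂ₓu` converge separately.

No eigenvalues. An eigenvector of the operator or of its adjoint satisfies `Dw = σ(c|ξ|²w + b)` with
`σ = 1` or `σ = -1` respectively, and `b` bounded pointwise by `w`. Along each line in the direction
`ξ₁` with `ξ₀ ≠ 0` the viscous term forces cubic exponential growth on one side, which is
incompatible with `L²`. To prove this by energy (`eq_zero_of_hasWeakShearDeriv`), apply
skew-symmetry to `mw` for a bounded weight `m`. The viscous term beats `b` where `|ξ₁|` is large,
and for moderate `ξ₁` the logarithmic derivative of `m`, of the form `A/(1+ξ₁²)` with `A` large,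
supplies the missing positivity. The energy identity then has an integrand at least `m²|w|²` and
integral zero. -/

theorem shift_apply {X : Type*} [NormedAddCommGroup X] [NormedSpace ℂ X] (T : X →ₗ.[ℂ] X)
    (lam : ℂ) (u : T.domain) : shift T lam u = lam • (u : X) - T u := rfl

theorem shift_injective_of_pointSpectrum_eq_empty {X : Type*} [NormedAddCommGroup X]
    [NormedSpace ℂ X] {T : X →ₗ.[ℂ] X} (h : pointSpectrum T = ∅) (lam : ℂ) :
    Function.Injective (shift T lam) := by
  rw [injective_iff_map_eq_zero]
  intro u hu
  by_contra hne
  have : lam ∈ pointSpectrum T := by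
    refine ⟨u, hne, ?_⟩
    rw [shift_apply, sub_eq_zero] at hu
    exact hu.symm
  simp [h] at this

/-- A closed operator is boundedly invertible as soon as it is bijective. -/
theorem mem_resolventSet_of_bijective {X : Type*} [NormedAddCommGroup X] [NormedSpace ℂ X]
    [CompleteSpace X] {T : X →ₗ.[ℂ] X} (hc : T.IsClosed) {lam : ℂ}
    (h : Function.Bijective (shift T lam)) : lam ∈ resolventSet T := by
  let e := LinearEquiv.ofBijective (shift T lam) h
  let R : X →ₗ[ℂ] X := T.domain.subtype ∘ₗ e.symm.toLinearMap
  -- The graph of the inverse is the graph of `T` pulled back along the continuous map `(x, y) ↦ (y,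
  -- λy - x)`, so closedness carries over.
  have hgraph : (R.graph : Set (X × X)) =
      (fun p : X × X => (p.2, lam • p.2 - p.1)) ⁻¹' (T.graph : Set (X × X)) := by
    ext ⟨x, y⟩
    simp only [SetLike.mem_coe, LinearMap.mem_graph_iff, Set.mem_preimage, LinearPMap.mem_graph_iff]
    constructor
    · rintro rfl
      refine ⟨e.symm x, rfl, ?_⟩
      have h1 : shift T lam (e.symm x) = x := e.apply_symm_apply x
      rw [shift_apply] at h1
      rw [eq_sub_iff_add_eq, add_comm, ← eq_sub_iff_add_eq]
      exact h1.symm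
    · rintro ⟨u, rfl, hu⟩
      have h1 : e u = x := by
        change shift T lam u = x
        rw [shift_apply, hu]
        abel
      simp [R, ← h1]
  have hclosed : IsClosed (R.graph : Set (X × X)) := by
    rw [hgraph]
    exact hc.preimage (by fun_prop)
  refine ⟨ContinuousLinearMap.ofIsClosedGraph hclosed, fun x => ⟨e.symm x, rfl, ?_⟩, fun u => ?_⟩
  · exact e.apply_symm_apply x
  · change ((e.symm (e u) : T.domain) : X) = u
    rw [e.symm_apply_apply]

/-- A vector `v` orthogonal to the range satisfies `⟨conj λ • v, u⟩ = ⟨v, Tu⟩` on the whole domain,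
so it lies in the adjoint's domain and is an eigenvector there for `conj λ` unless it vanishes. -/
theorem denseRange_shift_of_pointSpectrum_adjoint_eq_empty {X : Type*} [NormedAddCommGroup X]
    [InnerProductSpace ℂ X] [CompleteSpace X] {T : X →ₗ.[ℂ] X} (hd : Dense (T.domain : Set X))
    (h : pointSpectrum T.adjoint = ∅) (lam : ℂ) : DenseRange (shift T lam) := by
  have hbot : (LinearMap.range (shift T lam))ᗮ = ⊥ := by
    rw [Submodule.eq_bot_iff]
    intro v hv
    by_contra hne
    have key : ∀ u : T.domain, inner ℂ ((starRingEnd ℂ) lam • v) (u : X) = inner ℂ v (T u) := by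
      intro u
      have := (Submodule.mem_orthogonal' _ _).1 hv _ (LinearMap.mem_range_self (shift T lam) u)
      rw [shift_apply, inner_sub_right, sub_eq_zero, inner_smul_right] at this
      rw [inner_smul_left, Complex.conj_conj, this]
    have hv' : v ∈ T.adjoint.domain :=
      LinearPMap.mem_adjoint_domain_of_exists v ⟨_, key⟩
    have : (starRingEnd ℂ) lam ∈ pointSpectrum T.adjoint :=
      ⟨⟨v, hv'⟩, fun h0 => hne (congrArg Subtype.val h0),
        LinearPMap.adjoint_apply_eq hd ⟨v, hv'⟩ key⟩
    simp [h] at this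
  have := (Submodule.dense_iff_topologicalClosure_eq_top).2
    ((Submodule.topologicalClosure_eq_top_iff).2 hbot)
  rwa [LinearMap.coe_range] at this

/-- A densely defined closed operator without eigenvalues, whose adjoint has none either, has
purely continuous spectrum. -/
theorem spectrumOf_eq_continuousSpectrum {X : Type*} [NormedAddCommGroup X]
    [InnerProductSpace ℂ X] [CompleteSpace X] {T : X →ₗ.[ℂ] X} (hd : Dense (T.domain : Set X))
    (hc : T.IsClosed) (h : pointSpectrum T = ∅) (h' : pointSpectrum T.adjoint = ∅) :
    spectrumOf T = continuousSpectrum T := by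
  ext lam
  constructor
  · intro hlam
    have hinj := shift_injective_of_pointSpectrum_eq_empty h lam
    exact ⟨hinj, denseRange_shift_of_pointSpectrum_adjoint_eq_empty hd h' lam,
      fun hs => hlam (mem_resolventSet_of_bijective hc ⟨hinj, hs⟩)⟩
  · rintro ⟨-, -, hs⟩ ⟨R, hR, -⟩
    exact hs fun x => (hR x).imp fun u hu => hu.2

end Abstract

/-! ### The shear group -/

/-- The shear `ξ ↦ ξ + s ξ₀ e₁`. -/
def shear (s : ℝ) : Space →ₗ[ℝ] Space :=
  LinearMap.transvection ((EuclideanSpace.proj 0 : Space →L[ℝ] ℝ) : Space →ₗ[ℝ] ℝ)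
    (s • EuclideanSpace.single 1 1)

theorem shear_apply (s : ℝ) (ξ : Space) :
    shear s ξ = ξ + (s * ξ 0) • (EuclideanSpace.single 1 1 : Space) := by
  simp [shear, LinearMap.transvection, smul_smul, mul_comm]

theorem shear_apply_zero (s : ℝ) (ξ : Space) : shear s ξ 0 = ξ 0 := by
  simp [shear_apply]

theorem continuous_shear (s : ℝ) : Continuous (shear s) :=
  LinearMap.continuous_of_finiteDimensional _

theorem shear_shear (s t : ℝ) (ξ : Space) : shear s (shear t ξ) = shear (s + t) ξ := by
  rw [shear_apply, shear_apply_zero, shear_apply, shear_apply, add_assoc, ← add_smul]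
  congr 2
  ring

theorem shear_zero (ξ : Space) : shear 0 ξ = ξ := by simp [shear_apply]

/-- A transvection has determinant one. -/
theorem measurePreserving_shear (s : ℝ) : MeasurePreserving (shear s) volume volume := by
  have hdet : LinearMap.det (shear s) = 1 := by
    rw [shear, LinearMap.transvection.det]
    simp
  refine ⟨(continuous_shear s).measurable, ?_⟩
  rw [Measure.map_linearMap_addHaar_eq_smul_addHaar _ (by rw [hdet]; exact one_ne_zero), hdet]
  simp

theorem measurableEmbedding_shear (s : ℝ) : MeasurableEmbedding (shear s) := by
  refine MeasurableEmbedding.of_measurable_inverse (continuous_shear s).measurable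
    ?_ (continuous_shear (-s)).measurable (fun ξ => ?_)
  · have : Set.range (shear s) = Set.univ :=
      Set.range_eq_univ.2 fun ξ => ⟨shear (-s) ξ, by simp [shear_shear, shear_zero]⟩
    rw [this]; exact MeasurableSet.univ
  · simp [shear_shear, shear_zero]

/-- The shear derivative `ξ₀ ∂₁ φ`, generator of the shear group. -/
def shearDeriv (φ : Space → ℂ) (ξ : Space) : ℂ :=
  (ξ 0 : ℂ) * fderiv ℝ φ ξ (EuclideanSpace.single 1 1)

theorem hasDerivAt_comp_shear {φ : Space → ℂ} (hφ : Differentiable ℝ φ) (ξ : Space) (s : ℝ) :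
    HasDerivAt (fun t => φ (shear t ξ)) (shearDeriv φ (shear s ξ)) s := by
  have h1 : HasDerivAt (fun t : ℝ => shear t ξ)
      ((ξ 0) • (EuclideanSpace.single 1 1 : Space)) s := by
    simp only [shear_apply]
    have := ((hasDerivAt_mul_const (x := s) (ξ 0)).smul_const
      (EuclideanSpace.single 1 1 : Space)).const_add ξ
    exact this
  have h2 := (hφ (shear s ξ)).hasFDerivAt.comp_hasDerivAt s h1
  have h3 : shearDeriv φ (shear s ξ) =
      fderiv ℝ φ (shear s ξ) ((ξ 0) • (EuclideanSpace.single 1 1 : Space)) := by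
    rw [shearDeriv, shear_apply_zero, map_smul, Complex.real_smul]
  rw [h3]
  exact h2

/-- `g` is the derivative `ξ₀ ∂₁ u` in the sense of distributions. -/
def HasWeakShearDeriv (u g : Space → ℂ) : Prop :=
  ∀ φ : Space → ℂ, ContDiff ℝ (⊤ : ℕ∞) φ → HasCompactSupport φ →
    ∫ ξ, u ξ * shearDeriv φ ξ = -∫ ξ, g ξ * φ ξ

theorem continuous_shearDeriv {φ : Space → ℂ} (hφ : ContDiff ℝ (⊤ : ℕ∞) φ) :
    Continuous (shearDeriv φ) := by
  have := hφ.continuous_fderiv (by simp)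
  unfold shearDeriv
  fun_prop

theorem shearDeriv_eq_zero_of_notMem {φ : Space → ℂ} {ξ : Space} (h : ξ ∉ tsupport φ) :
    shearDeriv φ ξ = 0 := by
  have : fderiv ℝ φ ξ = 0 := by
    by_contra hne
    exact h (support_fderiv_subset ℝ hne)
  simp [shearDeriv, this]

theorem hasCompactSupport_shearDeriv {φ : Space → ℂ} (h : HasCompactSupport φ) :
    HasCompactSupport (shearDeriv φ) :=
  HasCompactSupport.intro h fun _ hx => shearDeriv_eq_zero_of_notMem hx

theorem contDiff_comp_shear {φ : Space → ℂ} (hφ : ContDiff ℝ (⊤ : ℕ∞) φ) (s : ℝ) :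
    ContDiff ℝ (⊤ : ℕ∞) (fun ξ => φ (shear s ξ)) :=
  hφ.comp (LinearMap.toContinuousLinearMap (shear s)).contDiff

theorem hasCompactSupport_comp_shear {φ : Space → ℂ} (h : HasCompactSupport φ) (s : ℝ) :
    HasCompactSupport (fun ξ => φ (shear s ξ)) := by
  refine HasCompactSupport.intro (h.image (continuous_shear (-s))) fun ξ hξ => ?_
  by_contra hne
  exact hξ ⟨shear s ξ, subset_tsupport _ hne, by simp [shear_shear, shear_zero]⟩

theorem shearDeriv_comp_shear {φ : Space → ℂ} (hφ : ContDiff ℝ (⊤ : ℕ∞) φ) (s : ℝ) (ξ : Space) :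
    shearDeriv (fun η => φ (shear s η)) ξ = shearDeriv φ (shear s ξ) := by
  have h1 := hasDerivAt_comp_shear ((contDiff_comp_shear hφ s).differentiable (by simp)) ξ 0
  have h2 := (hasDerivAt_comp_shear (hφ.differentiable (by simp)) (shear s ξ) 0)
  simp only [shear_shear, shear_zero, zero_add] at h1 h2
  simp only [add_comm s] at h1
  exact h1.unique h2

theorem memLp_of_test {φ : Space → ℂ} (hφ : ContDiff ℝ (⊤ : ℕ∞) φ) (hc : HasCompactSupport φ) :
    MemLp φ 2 :=
  hφ.continuous.memLp_of_hasCompactSupport hc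

theorem locallyIntegrable_L2 (u : L2) : LocallyIntegrable u :=
  (Lp.memLp u).locallyIntegrable (by norm_num)

theorem integrable_mul_test {u φ : Space → ℂ} (hu : LocallyIntegrable u) (hφ : Continuous φ)
    (hc : HasCompactSupport φ) : Integrable fun ξ => u ξ * φ ξ := by
  simpa [mul_comm] using hu.integrable_smul_left_of_hasCompactSupport hφ hc

/-- Differentiation under the integral sign. For `t` near `s` the sheared test functions live in one
compact set, on which a locally integrable `u` is integrable. -/
theorem hasDerivAt_integral_mul_comp_shear {u : Space → ℂ} (hu : LocallyIntegrable u)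
    {φ : Space → ℂ} (hφ : ContDiff ℝ (⊤ : ℕ∞) φ) (hc : HasCompactSupport φ) (s : ℝ) :
    HasDerivAt (fun t => ∫ ξ, u ξ * φ (shear t ξ)) (∫ ξ, u ξ * shearDeriv φ (shear s ξ)) s := by
  obtain ⟨C, hC⟩ := (continuous_shearDeriv hφ).bounded_above_of_compact_support
    (hasCompactSupport_shearDeriv hc)
  -- The region swept out by the support of `φ` under the inverse shears with `|t - s| ≤ 1`.
  let K : Set Space := (fun p : ℝ × Space => shear (-p.1) p.2) ''
    (Metric.closedBall s 1 ×ˢ tsupport φ)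
  have hcont : Continuous (fun p : ℝ × Space => shear (-p.1) p.2) := by
    simp only [shear_apply]
    fun_prop
  have hK : IsCompact K := ((isCompact_closedBall s 1).prod hc).image hcont
  have hzero : ∀ t ∈ Metric.closedBall s 1, ∀ ξ ∉ K, shearDeriv φ (shear t ξ) = 0 := by
    intro t ht ξ hξ
    refine shearDeriv_eq_zero_of_notMem fun h => hξ ⟨(t, shear t ξ), ⟨ht, h⟩, ?_⟩
    simp [shear_shear, shear_zero]
  refine (hasDerivAt_integral_of_dominated_loc_of_deriv_le (s := Metric.closedBall s 1)
    (F := fun t ξ => u ξ * φ (shear t ξ)) (F' := fun t ξ => u ξ * shearDeriv φ (shear t ξ))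
    (bound := K.indicator fun ξ => ‖u ξ‖ * C)
    (Metric.closedBall_mem_nhds s one_pos) ?_ ?_ ?_ ?_ ?_ ?_).2
  · exact Filter.Eventually.of_forall fun t => hu.aestronglyMeasurable.mul
      (hφ.continuous.comp (continuous_shear t)).aestronglyMeasurable
  · exact integrable_mul_test hu (hφ.continuous.comp (continuous_shear s))
      (hasCompactSupport_comp_shear hc s)
  · exact hu.aestronglyMeasurable.mul
      ((continuous_shearDeriv hφ).comp (continuous_shear s)).aestronglyMeasurable
  · refine Filter.Eventually.of_forall fun ξ t ht => ?_
    by_cases hξ : ξ ∈ K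
    · rw [Set.indicator_of_mem hξ, norm_mul]
      exact mul_le_mul_of_nonneg_left (hC _) (norm_nonneg _)
    · rw [Set.indicator_of_notMem hξ, hzero t ht ξ hξ, mul_zero, norm_zero]
  · rw [integrable_indicator_iff hK.measurableSet]
    exact ((hu.integrableOn_isCompact hK).norm).mul_const C
  · exact Filter.Eventually.of_forall fun ξ t _ =>
      (hasDerivAt_comp_shear (hφ.differentiable (by simp)) ξ t).const_mul (u ξ)

/-- The classes in `L²` of smooth compactly supported functions. -/
def testSubmodule : Submodule ℂ L2 where
  carrier := {Φ | ∃ φ : Space → ℂ, ContDiff ℝ (⊤ : ℕ∞) φ ∧ HasCompactSupport φ ∧ Φ =ᵐ[volume] φ}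
  zero_mem' := ⟨0, contDiff_const, HasCompactSupport.zero, Lp.coeFn_zero _ _ _⟩
  add_mem' := by
    rintro Φ Ψ ⟨φ, h1, h2, h3⟩ ⟨ψ, h4, h5, h6⟩
    exact ⟨φ + ψ, h1.add h4, h2.add h5, (Lp.coeFn_add Φ Ψ).trans (h3.add h6)⟩
  smul_mem' := by
    rintro c Φ ⟨φ, h1, h2, h3⟩
    exact ⟨c • φ, h1.const_smul c, h2.smul_left (f := fun _ => c),
      (Lp.coeFn_smul c Φ).trans (h3.const_smul c)⟩

theorem L2_inner_eq (u v : L2) : inner ℂ u v = ∫ ξ, v ξ * star (u ξ) := by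
  rw [L2.inner_def]
  rfl

/-- A vector orthogonal to all test functions vanishes almost everywhere, by the fundamental lemma
of the calculus of variations. -/
theorem dense_testSubmodule : Dense (testSubmodule : Set L2) := by
  rw [Submodule.dense_iff_topologicalClosure_eq_top, Submodule.topologicalClosure_eq_top_iff,
    Submodule.eq_bot_iff]
  intro v hv
  have h0 := ae_eq_zero_of_integral_contDiff_smul_eq_zero (locallyIntegrable_L2 v)
    fun g hg hgc => ?_
  · exact Lp.eq_zero_iff_ae_eq_zero.2 h0
  · have hg1 : ContDiff ℝ (⊤ : ℕ∞) (fun ξ => (g ξ : ℂ)) := Complex.ofRealCLM.contDiff.comp hg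
    have hg2 : HasCompactSupport (fun ξ => (g ξ : ℂ)) :=
      hgc.comp_left (g := Complex.ofReal) Complex.ofReal_zero
    have := (Submodule.mem_orthogonal _ _).1 hv ((memLp_of_test hg1 hg2).toLp _)
      ⟨_, hg1, hg2, MemLp.coeFn_toLp _⟩
    rw [L2_inner_eq] at this
    rw [← this]
    refine integral_congr_ae ?_
    filter_upwards [(memLp_of_test hg1 hg2).coeFn_toLp] with ξ hξ
    rw [hξ]
    simp [mul_comm]

/-- Composition with the shears, as isometries of `L²`. -/
def shearL2 (s : ℝ) : L2 →ₗᵢ[ℂ] L2 :=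
  Lp.compMeasurePreservingₗᵢ ℂ (shear s) (measurePreserving_shear s)

theorem shearL2_ae (s : ℝ) (u : L2) : shearL2 s u =ᵐ[volume] fun ξ => u (shear s ξ) :=
  Lp.coeFn_compMeasurePreserving u (measurePreserving_shear s)

theorem star_test {φ : Space → ℂ} (hφ : ContDiff ℝ (⊤ : ℕ∞) φ) (hc : HasCompactSupport φ) :
    ContDiff ℝ (⊤ : ℕ∞) (fun ξ => star (φ ξ)) ∧ HasCompactSupport (fun ξ => star (φ ξ)) :=
  ⟨Complex.conjCLE.contDiff.comp hφ, hc.comp_left (g := star) (star_zero _)⟩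

/-- Change of variables: shearing the test function forwards amounts to shearing `u` backwards. -/
theorem integral_mul_comp_shear {Φ : L2} {φ : Space → ℂ} (h : Φ =ᵐ[volume] φ) (u : L2) (s : ℝ) :
    ∫ ξ, u ξ * star (φ (shear s ξ)) = inner ℂ Φ (shearL2 (-s) u) := by
  rw [L2_inner_eq, ← (measurePreserving_shear s).integral_comp (measurableEmbedding_shear s)
    fun ξ => shearL2 (-s) u ξ * star (Φ ξ)]
  refine integral_congr_ae ?_
  filter_upwards [(measurePreserving_shear s).quasiMeasurePreserving.ae (shearL2_ae (-s) u),
    (measurePreserving_shear s).quasiMeasurePreserving.ae h] with ξ h1 h2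
  rw [h1, h2, shear_shear, neg_add_cancel, shear_zero]

/-- The weak derivative generates the shear group in the weak sense: `D` commutes with the shears,
so the sheared test function is again admissible in the definition. -/
theorem hasDerivAt_inner_shearL2 {u g : L2} (h : HasWeakShearDeriv u g) {Φ : L2}
    (hΦ : Φ ∈ testSubmodule) (s : ℝ) :
    HasDerivAt (fun t => inner ℂ Φ (shearL2 (-t) u)) (-inner ℂ Φ (shearL2 (-s) g)) s := by
  obtain ⟨φ, h1, h2, h3⟩ := hΦ
  obtain ⟨h1', h2'⟩ := star_test h1 h2
  have := hasDerivAt_integral_mul_comp_shear (locallyIntegrable_L2 u) h1' h2' s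
  simp only [integral_mul_comp_shear h3 u] at this
  rw [← integral_mul_comp_shear h3 g, ← h _ (contDiff_comp_shear h1' s)
    (hasCompactSupport_comp_shear h2' s)]
  simpa only [shearDeriv_comp_shear h1'] using this

theorem norm_inner_shearL2_sub_le {u g : L2} (h : HasWeakShearDeriv u g) (Φ : L2) (s : ℝ) :
    ‖inner ℂ Φ (shearL2 (-s) u - u)‖ ≤ ‖Φ‖ * ‖g‖ * |s| := by
  refine dense_testSubmodule.induction (P := fun Φ =>
    ‖inner ℂ Φ (shearL2 (-s) u - u)‖ ≤ ‖Φ‖ * ‖g‖ * |s|) (fun Ψ hΨ => ?_) ?_ Φ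
  · have := (convex_univ (𝕜 := ℝ) (E := ℝ)).norm_image_sub_le_of_norm_hasDerivWithin_le
      (C := ‖Ψ‖ * ‖g‖) (fun t _ => (hasDerivAt_inner_shearL2 h hΨ t).hasDerivWithinAt)
      (fun t _ => ?_) (Set.mem_univ 0) (Set.mem_univ s)
    · have h0 : shearL2 0 u = u := by
        refine Lp.ext ((shearL2_ae 0 u).trans ?_)
        simp [shear_zero]
      simpa [inner_sub_right, h0] using this
    · rw [norm_neg]
      exact (norm_inner_le_norm _ _).trans_eq (by rw [LinearIsometry.norm_map])
  · exact isClosed_le (by fun_prop) (by fun_prop)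

/-- The weak estimate holds for every `Φ`; taking `Φ` to be the increment itself makes it a norm
estimate. -/
theorem norm_shearL2_sub_le {u g : L2} (h : HasWeakShearDeriv u g) (s : ℝ) :
    ‖shearL2 (-s) u - u‖ ≤ ‖g‖ * |s| := by
  have := norm_inner_shearL2_sub_le h (shearL2 (-s) u - u) s
  rw [inner_self_eq_norm_sq_to_K] at this
  rcases eq_or_lt_of_le (norm_nonneg (shearL2 (-s) u - u)) with h0 | h0
  · rw [← h0]; positivity
  · refine le_of_mul_le_mul_left ?_ h0
    simpa [pow_two, mul_assoc] using this

/-- The shear derivative is skew-symmetric. -/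
theorem re_inner_weakShearDeriv_eq_zero {u g : L2} (h : HasWeakShearDeriv u g) :
    (inner ℂ u g).re = 0 := by
  -- The weak derivative of the orbit is known only against test functions, so `u` is approximated
  -- by `Φ` with an error that vanishes as `Φ` tends to `u`.
  have key : ∀ Φ : L2, |(inner ℂ Φ g).re| ≤ ‖u - Φ‖ * ‖g‖ := by
    intro Φ
    refine dense_testSubmodule.induction (P := fun Φ =>
      |(inner ℂ Φ g).re| ≤ ‖u - Φ‖ * ‖g‖) (fun Ψ hΨ => ?_) ?_ Φ
    · refine le_of_forall_pos_le_add fun ε hε => ?_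
      have h0 : shearL2 0 u = u := by
        refine Lp.ext ((shearL2_ae 0 u).trans ?_)
        simp [shear_zero]
      have h0' : shearL2 0 g = g := by
        refine Lp.ext ((shearL2_ae 0 g).trans ?_)
        simp [shear_zero]
      have hd := Complex.reCLM.hasFDerivAt.comp_hasDerivAt (0 : ℝ)
        (hasDerivAt_inner_shearL2 h hΨ 0)
      -- A local Lipschitz constant at `0` bounds the derivative there. The `ε` absorbs the
      -- quadratic term `‖w‖²/2 ≤ ‖g‖²s²/2`.
      have hb := hd.le_of_lip' (C := ‖u - Ψ‖ * ‖g‖ + ε) (by positivity) ?_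
      · simpa [h0'] using hb
      · have hsmall : ∀ᶠ s : ℝ in nhds 0, ‖g‖ ^ 2 / 2 * |s| ≤ ε := by
          have : Filter.Tendsto (fun s : ℝ => ‖g‖ ^ 2 / 2 * |s|) (nhds 0) (nhds 0) := by
            have : Continuous (fun s : ℝ => ‖g‖ ^ 2 / 2 * |s|) := by fun_prop
            simpa using this.tendsto 0
          exact (this.eventually (gt_mem_nhds hε)).mono fun _ => le_of_lt
        filter_upwards [hsmall] with s hs
        set w := shearL2 (-s) u - u with hw
        have hwn : ‖w‖ ≤ ‖g‖ * |s| := norm_shearL2_sub_le h s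
        -- The shear preserves norms, so `‖u + w‖ = ‖u‖`; the first-order term of `Re⟨u, w⟩`
        -- therefore vanishes.
        have e1 : (inner ℂ u w).re = -‖w‖ ^ 2 / 2 := by
          have := norm_add_sq (𝕜 := ℂ) u w
          have e2 : ‖u + w‖ = ‖u‖ := by rw [hw, add_sub_cancel, LinearIsometry.norm_map]
          rw [e2] at this
          simp only [RCLike.re_to_complex] at this
          linarith
        have e3 : |(inner ℂ (u - Ψ) w).re| ≤ ‖u - Ψ‖ * (‖g‖ * |s|) :=
          (Complex.abs_re_le_norm _).trans ((norm_inner_le_norm _ _).trans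
            (mul_le_mul_of_nonneg_left hwn (norm_nonneg _)))
        have e4 : (inner ℂ Ψ w).re = -‖w‖ ^ 2 / 2 - (inner ℂ (u - Ψ) w).re := by
          rw [inner_sub_left, Complex.sub_re, e1]; ring
        have e5 : ‖w‖ ^ 2 ≤ (‖g‖ * |s|) ^ 2 := by gcongr
        have e6 : ‖g‖ ^ 2 / 2 * |s| * |s| ≤ ε * |s| := by gcongr
        have e7 : |(inner ℂ Ψ w).re| ≤ (‖u - Ψ‖ * ‖g‖ + ε) * |s| := by
          rw [e4]
          refine (abs_sub _ _).trans ?_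
          rw [abs_div, abs_neg, abs_of_nonneg (by positivity : (0:ℝ) ≤ ‖w‖ ^ 2), abs_two]
          nlinarith
        simpa [h0, hw, inner_sub_right] using e7
    · exact isClosed_le (by fun_prop) (by fun_prop)
  have := key u
  simpa using this

/-! ### Calculus of weak shear derivatives. -/

theorem HasWeakShearDeriv.add {u g v h : Space → ℂ} (hu : LocallyIntegrable u)
    (hg : LocallyIntegrable g) (hv : LocallyIntegrable v) (hh : LocallyIntegrable h)
    (h1 : HasWeakShearDeriv u g) (h2 : HasWeakShearDeriv v h) :
    HasWeakShearDeriv (u + v) (g + h) := by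
  intro φ hφ hc
  have hD := continuous_shearDeriv hφ
  have hDc := hasCompactSupport_shearDeriv hc
  simp only [Pi.add_apply, add_mul]
  rw [integral_add (integrable_mul_test hu hD hDc) (integrable_mul_test hv hD hDc),
    integral_add (integrable_mul_test hg hφ.continuous hc)
      (integrable_mul_test hh hφ.continuous hc), h1 φ hφ hc, h2 φ hφ hc]
  ring

theorem HasWeakShearDeriv.congr {u g u' g' : Space → ℂ} (h : HasWeakShearDeriv u g)
    (hu : u =ᵐ[volume] u') (hg : g =ᵐ[volume] g') : HasWeakShearDeriv u' g' := by
  intro φ hφ hc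
  have h1 : ∫ ξ, u' ξ * shearDeriv φ ξ = ∫ ξ, u ξ * shearDeriv φ ξ :=
    integral_congr_ae (by filter_upwards [hu] with ξ h; rw [h])
  have h2 : ∫ ξ, g' ξ * φ ξ = ∫ ξ, g ξ * φ ξ :=
    integral_congr_ae (by filter_upwards [hg] with ξ h; rw [h])
  rw [h1, h2, h φ hφ hc]

/-- Skew-symmetry of the shear derivative, in polarized form. -/
theorem re_inner_weakShearDeriv_add_eq_zero {u g v h : L2} (h1 : HasWeakShearDeriv u g)
    (h2 : HasWeakShearDeriv v h) : (inner ℂ u h).re + (inner ℂ v g).re = 0 := by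
  have h3 : HasWeakShearDeriv (u + v : L2) (g + h : L2) :=
    (HasWeakShearDeriv.add (locallyIntegrable_L2 u) (locallyIntegrable_L2 g)
      (locallyIntegrable_L2 v) (locallyIntegrable_L2 h) h1 h2).congr
      (Lp.coeFn_add _ _).symm (Lp.coeFn_add _ _).symm
  have e := re_inner_weakShearDeriv_eq_zero h3
  rw [inner_add_left, inner_add_right, inner_add_right, Complex.add_re, Complex.add_re,
    Complex.add_re, re_inner_weakShearDeriv_eq_zero h1, re_inner_weakShearDeriv_eq_zero h2] at e
  linarith

theorem shearDeriv_mul {m φ : Space → ℂ} (hm : ContDiff ℝ (⊤ : ℕ∞) m)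
    (hφ : ContDiff ℝ (⊤ : ℕ∞) φ) (ξ : Space) :
    shearDeriv (fun η => m η * φ η) ξ = m ξ * shearDeriv φ ξ + shearDeriv m ξ * φ ξ := by
  have h1 := hm.differentiable (by simp) ξ
  have h2 := hφ.differentiable (by simp) ξ
  simp only [shearDeriv, fderiv_fun_mul h1 h2, add_apply, smul_apply, smul_eq_mul]
  ring

/-- Product rule. -/
theorem HasWeakShearDeriv.mul {u g m : Space → ℂ} (h : HasWeakShearDeriv u g)
    (hu : LocallyIntegrable u) (hg : LocallyIntegrable g) (hm : ContDiff ℝ (⊤ : ℕ∞) m) :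
    HasWeakShearDeriv (fun ξ => m ξ * u ξ) (fun ξ => m ξ * g ξ + shearDeriv m ξ * u ξ) := by
  intro φ hφ hc
  have hmφ : ContDiff ℝ (⊤ : ℕ∞) (fun ξ => m ξ * φ ξ) := hm.mul hφ
  have hmc : HasCompactSupport (fun ξ => m ξ * φ ξ) := hc.mul_left
  have hmc' : HasCompactSupport (fun ξ => shearDeriv m ξ * φ ξ) := hc.mul_left
  have h1 := h _ hmφ hmc
  simp only [shearDeriv_mul hm hφ, mul_add] at h1
  have i1 := integrable_mul_test hu (hm.continuous.mul (continuous_shearDeriv hφ))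
    ((hasCompactSupport_shearDeriv hc).mul_left)
  have i2 := integrable_mul_test hu ((continuous_shearDeriv hm).mul hφ.continuous) hmc'
  have i3 := integrable_mul_test hg hmφ.continuous hmc
  simp only [Pi.mul_apply] at i1 i2
  rw [integral_add i1 i2] at h1
  have e1 : ∫ ξ, m ξ * u ξ * shearDeriv φ ξ = ∫ ξ, u ξ * (m ξ * shearDeriv φ ξ) :=
    integral_congr_ae (Filter.Eventually.of_forall fun ξ => by ring)
  have e2 : ∫ ξ, (m ξ * g ξ + shearDeriv m ξ * u ξ) * φ ξ =
      (∫ ξ, g ξ * (m ξ * φ ξ)) + ∫ ξ, u ξ * (shearDeriv m ξ * φ ξ) := by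
    rw [← integral_add i3 i2]
    exact integral_congr_ae (Filter.Eventually.of_forall fun ξ => by ring)
  rw [e1, e2, neg_add, ← h1]
  ring

theorem exists_mul_L2 {m : Space → ℂ} (hm : Continuous m) {C : ℝ} (hC : ∀ ξ, ‖m ξ‖ ≤ C) (u : L2) :
    ∃ v : L2, v =ᵐ[volume] fun ξ => m ξ * u ξ := by
  have : MemLp (fun ξ => m ξ * u ξ) 2 := by
    refine (Lp.memLp u).of_le_mul (c := C)
      (hm.aestronglyMeasurable.mul (Lp.aestronglyMeasurable u))
      (Filter.Eventually.of_forall fun ξ => ?_)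
    rw [norm_mul]
    exact mul_le_mul_of_nonneg_right (hC ξ) (norm_nonneg _)
  exact ⟨this.toLp _, this.coeFn_toLp⟩

theorem norm_sq_eq_coords (ξ : Space) : ‖ξ‖ ^ 2 = ξ 0 ^ 2 + ξ 1 ^ 2 + ξ 2 ^ 2 := by
  rw [EuclideanSpace.norm_sq_eq, Fin.sum_univ_three]
  simp

theorem shear_coords (s : ℝ) (ξ : Space) :
    shear s ξ 0 = ξ 0 ∧ shear s ξ 1 = ξ 1 + s * ξ 0 ∧ shear s ξ 2 = ξ 2 := by
  refine ⟨shear_apply_zero s ξ, ?_, ?_⟩ <;> simp [shear_apply]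

theorem shearDeriv_ofReal_eq {m : Space → ℝ} (hm : ContDiff ℝ (⊤ : ℕ∞) m) {ξ : Space} {q : ℝ}
    (h : HasDerivAt (fun t => m (shear t ξ)) q 0) :
    shearDeriv (fun η => (m η : ℂ)) ξ = q := by
  have hm' : ContDiff ℝ (⊤ : ℕ∞) (fun η => (m η : ℂ)) := Complex.ofRealCLM.contDiff.comp hm
  have h1 := hasDerivAt_comp_shear (hm'.differentiable (by simp)) ξ 0
  rw [shear_zero] at h1
  exact h1.unique h.ofReal_comp

theorem hasDerivAt_normSq_shear (ξ : Space) :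
    HasDerivAt (fun t => ‖shear t ξ‖ ^ 2) (2 * (ξ 0 * ξ 1)) 0 := by
  simp only [norm_sq_eq_coords, (shear_coords _ ξ).1, (shear_coords _ ξ).2.1,
    (shear_coords _ ξ).2.2]
  have h := ((((hasDerivAt_id (0 : ℝ)).mul_const (ξ 0)).const_add (ξ 1)).pow 2).const_add (ξ 0 ^ 2)
  refine (h.add_const (ξ 2 ^ 2)).congr_deriv ?_
  simp
  ring

theorem abs_two_mul_coords_le (ξ : Space) : |2 * (ξ 0 * ξ 1)| ≤ ‖ξ‖ ^ 2 := by
  rw [norm_sq_eq_coords, abs_le]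
  constructor <;> nlinarith [sq_nonneg (ξ 0 + ξ 1), sq_nonneg (ξ 0 - ξ 1), sq_nonneg (ξ 2)]

/-! ### The truncated weight and the separate control of viscosity. -/

/-- The bounded approximations `n c|ξ|² / (n + c|ξ|²)` of `c|ξ|²`. -/
def truncWeight (c n : ℝ) (ξ : Space) : ℝ := n * (c * ‖ξ‖ ^ 2) / (n + c * ‖ξ‖ ^ 2)

section Trunc

variable {c n : ℝ}

theorem contDiff_truncWeight (hc : 0 < c) (hn : 0 < n) : ContDiff ℝ (⊤ : ℕ∞) (truncWeight c n) := by
  have h : ContDiff ℝ (⊤ : ℕ∞) (fun ξ : Space => ‖ξ‖ ^ 2) := contDiff_norm_sq ℝ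
  exact (contDiff_const.mul (contDiff_const.mul h)).div
    (contDiff_const.add (contDiff_const.mul h)) fun ξ => by positivity

theorem truncWeight_nonneg (hc : 0 < c) (hn : 0 < n) (ξ : Space) : 0 ≤ truncWeight c n ξ := by
  unfold truncWeight; positivity

theorem truncWeight_le (hc : 0 < c) (hn : 0 < n) (ξ : Space) : truncWeight c n ξ ≤ n := by
  unfold truncWeight
  rw [div_le_iff₀ (by positivity)]
  nlinarith [sq_nonneg n]

theorem truncWeight_le' (hc : 0 < c) (hn : 0 < n) (ξ : Space) :
    truncWeight c n ξ ≤ c * ‖ξ‖ ^ 2 := by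
  unfold truncWeight
  rw [div_le_iff₀ (by positivity)]
  nlinarith [sq_nonneg (c * ‖ξ‖ ^ 2)]

/-- With `a = c|ξ|²`, the derivative of `na/(n+a)` is `(n/(n+a))²Da`. As `|Da| ≤ a` and `n/(n+a) ≤
1`, it is at most the weight itself, uniformly in `n`. -/
theorem shearDeriv_truncWeight (hc : 0 < c) (hn : 0 < n) (ξ : Space) :
    ∃ q : ℝ, shearDeriv (fun η => (truncWeight c n η : ℂ)) ξ = q ∧ |q| ≤ truncWeight c n ξ := by
  have hpos : 0 < n + c * ‖ξ‖ ^ 2 := by positivity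
  have h1 := (hasDerivAt_normSq_shear ξ).const_mul c
  have h2 := (h1.const_mul n).div (h1.const_add n) (by simpa [shear_zero] using hpos.ne')
  simp only [shear_zero] at h2
  refine ⟨_, shearDeriv_ofReal_eq (contDiff_truncWeight hc hn) h2, ?_⟩
  have e : (n * (c * (2 * (ξ 0 * ξ 1))) * (n + c * ‖ξ‖ ^ 2) -
      n * (c * ‖ξ‖ ^ 2) * (c * (2 * (ξ 0 * ξ 1)))) / (n + c * ‖ξ‖ ^ 2) ^ 2 =
      (n * c / (n + c * ‖ξ‖ ^ 2)) * (n / (n + c * ‖ξ‖ ^ 2)) * (2 * (ξ 0 * ξ 1)) := by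
    field_simp
    ring
  rw [e, abs_mul, abs_of_nonneg (by positivity)]
  have e2 : truncWeight c n ξ = (n * c / (n + c * ‖ξ‖ ^ 2)) * 1 * ‖ξ‖ ^ 2 := by
    unfold truncWeight; field_simp
  rw [e2]
  have h3 : n / (n + c * ‖ξ‖ ^ 2) ≤ 1 := by
    rw [div_le_one hpos]
    have : 0 ≤ c * ‖ξ‖ ^ 2 := by positivity
    linarith
  gcongr
  exact abs_two_mul_coords_le ξ

end Trunc

theorem integrable_mul_star (u v : L2) : Integrable fun ξ => v ξ * star (u ξ) := by
  have := L2.integrable_inner (𝕜 := ℂ) u v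
  exact this

theorem re_inner_eq (u v : L2) : (inner ℂ u v).re = ∫ ξ, (v ξ * star (u ξ)).re := by
  rw [L2_inner_eq]
  exact (integral_re (integrable_mul_star u v)).symm

theorem integrable_re_mul_star (u v : L2) : Integrable fun ξ => (v ξ * star (u ξ)).re :=
  (integrable_mul_star u v).re

theorem re_ofReal_mul_mul_star (r s : ℝ) (z : ℂ) :
    ((r : ℂ) * z * star ((s : ℂ) * z)).re = r * s * ‖z‖ ^ 2 := by
  have h1 : z * star z = ((‖z‖ ^ 2 : ℝ) : ℂ) := by
    rw [← Complex.normSq_eq_norm_sq, ← Complex.mul_conj]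
    rfl
  have h2 : star (s : ℂ) = s := Complex.conj_ofReal s
  have : (r : ℂ) * z * star ((s : ℂ) * z) = ((r * s : ℝ) : ℂ) * (z * star z) := by
    rw [star_mul', h2]
    push_cast
    ring
  rw [this, h1, ← Complex.ofReal_mul, Complex.ofReal_re]

/-- Separate control of the viscous term `c|ξ|² u` by `ξ₀ ∂₁ u - c|ξ|² u` and `u`. -/
theorem norm_le_of_hasWeakShearDeriv {c : ℝ} (hc : 0 < c) {u g p : L2}
    (h : HasWeakShearDeriv u g) (hp : p =ᵐ[volume] fun ξ => ((c * ‖ξ‖ ^ 2 : ℝ) : ℂ) * u ξ) :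
    ‖p‖ ≤ ‖g - p‖ + ‖u‖ / 2 := by
  have key : ∀ n : ℝ, 0 < n → ∃ v : L2, (v =ᵐ[volume] fun ξ => (truncWeight c n ξ : ℂ) * u ξ) ∧
      ‖v‖ ≤ ‖g - p‖ + ‖u‖ / 2 := by
    intro n hn
    have hsm : ContDiff ℝ (⊤ : ℕ∞) (fun ξ => (truncWeight c n ξ : ℂ)) :=
      Complex.ofRealCLM.contDiff.comp (contDiff_truncWeight hc hn)
    have hbd : ∀ ξ, ‖(truncWeight c n ξ : ℂ)‖ ≤ n := fun ξ => by
      rw [Complex.norm_real, Real.norm_eq_abs, abs_of_nonneg (truncWeight_nonneg hc hn ξ)]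
      exact truncWeight_le hc hn ξ
    have hbd' : ∀ ξ, ‖shearDeriv (fun η => (truncWeight c n η : ℂ)) ξ‖ ≤ n := fun ξ => by
      obtain ⟨q, hq, hq'⟩ := shearDeriv_truncWeight hc hn ξ
      rw [hq, Complex.norm_real, Real.norm_eq_abs]
      exact hq'.trans (truncWeight_le hc hn ξ)
    obtain ⟨v, hv⟩ := exists_mul_L2 hsm.continuous hbd u
    obtain ⟨v', hv'⟩ := exists_mul_L2 hsm.continuous hbd g
    obtain ⟨w, hw⟩ := exists_mul_L2 (continuous_shearDeriv hsm) hbd' u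
    refine ⟨v, hv, ?_⟩
    have hweak : HasWeakShearDeriv v (v' + w : L2) := by
      refine (h.mul (locallyIntegrable_L2 u) (locallyIntegrable_L2 g) hsm).congr hv.symm ?_
      filter_upwards [hv', hw, Lp.coeFn_add v' w] with ξ h1 h2 h3
      rw [h3, Pi.add_apply, h1, h2]
    -- With `v = mu` this reads `2 Re⟨v, g⟩ = -Re⟨u, (Dm)u⟩`, and the right side is at most `⟨u, mu⟩
    -- ≤ ‖u‖‖v‖` because `|Dm| ≤ m`; hence the `‖u‖ / 2`.
    have e0 := re_inner_weakShearDeriv_add_eq_zero h hweak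
    have e1 : (inner ℂ u v').re = (inner ℂ v g).re := by
      rw [re_inner_eq, re_inner_eq]
      refine integral_congr_ae ?_
      filter_upwards [hv, hv'] with ξ h1 h2
      rw [h1, h2, star_mul']
      simp
      ring
    have e2 : |(inner ℂ u w).re| ≤ (inner ℂ u v).re := by
      rw [re_inner_eq, re_inner_eq, ← Real.norm_eq_abs]
      refine norm_integral_le_of_norm_le (integrable_re_mul_star u v) ?_
      filter_upwards [hv, hw] with ξ h1 h2
      obtain ⟨q, hq, hq'⟩ := shearDeriv_truncWeight hc hn ξ
      have e (r : ℝ) : ((r : ℂ) * u ξ * star (u ξ)).re = r * ‖u ξ‖ ^ 2 := by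
        simpa using re_ofReal_mul_mul_star r 1 (u ξ)
      rw [h1, h2, hq, e, e, Real.norm_eq_abs, abs_mul, abs_of_nonneg (sq_nonneg ‖u ξ‖)]
      gcongr
    have e3 : ‖v‖ ^ 2 ≤ (inner ℂ v p).re := by
      have : (inner ℂ v v).re = ‖v‖ ^ 2 := inner_self_eq_norm_sq (𝕜 := ℂ) v
      rw [← this, re_inner_eq, re_inner_eq]
      refine integral_mono_ae (integrable_re_mul_star v v) (integrable_re_mul_star v p) ?_
      filter_upwards [hv, hp] with ξ h1 h2
      rw [h1, h2, re_ofReal_mul_mul_star, re_ofReal_mul_mul_star]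
      have := truncWeight_nonneg hc hn ξ
      have := truncWeight_le' hc hn ξ
      gcongr
    have e4 : (inner ℂ v p).re = (inner ℂ v g).re - (inner ℂ v (g - p)).re := by
      rw [inner_sub_right, Complex.sub_re]; ring
    have e5 : |(inner ℂ v (g - p)).re| ≤ ‖v‖ * ‖g - p‖ :=
      (Complex.abs_re_le_norm _).trans (norm_inner_le_norm _ _)
    have e6 : (inner ℂ u v).re ≤ ‖u‖ * ‖v‖ :=
      (Complex.re_le_norm _).trans (norm_inner_le_norm _ _)
    rw [inner_add_right, Complex.add_re, e1] at e0
    have e7 : ‖v‖ * ‖v‖ ≤ ‖v‖ * (‖g - p‖ + ‖u‖ / 2) := by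
      have := abs_le.1 e2
      have := abs_le.1 e5
      nlinarith
    rcases eq_or_lt_of_le (norm_nonneg v) with h0 | h0
    · rw [← h0]; positivity
    · exact le_of_mul_le_mul_left e7 h0
  -- The bound does not depend on the truncation, so Fatou's lemma passes it to the limit. The shift
  -- `n + 1` keeps the parameter positive.
  choose v hv hv' using fun n : ℕ => key (n + 1) (by positivity)
  have hlim : ∀ᵐ ξ, Filter.Tendsto (fun n => v n ξ) Filter.atTop (nhds (p ξ)) := by
    filter_upwards [ae_all_iff.2 hv, hp] with ξ h1 h2
    rw [h2]
    simp only [h1]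
    refine Filter.Tendsto.mul_const _ ?_
    refine (Complex.continuous_ofReal.tendsto _).comp ?_
    set a := c * ‖ξ‖ ^ 2
    have ha : 0 ≤ a := by positivity
    -- Uses `Na/(N+a) = a - a²/(N+a)` with `N = n + 1`.
    have h3 : Filter.Tendsto (fun n : ℕ => a - a ^ 2 / ((n : ℝ) + (1 + a))) Filter.atTop
        (nhds (a - 0)) :=
      tendsto_const_nhds.sub (tendsto_const_nhds.div_atTop
        (Filter.tendsto_atTop_add_const_right _ _ tendsto_natCast_atTop_atTop))
    rw [sub_zero] at h3
    refine h3.congr fun n => ?_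
    change _ = ((n : ℝ) + 1) * a / ((n : ℝ) + 1 + a)
    field_simp
    ring
  have hfatou := Lp.eLpNorm_lim_le_liminf_eLpNorm (p := 2)
    (fun n => Lp.aestronglyMeasurable (v n)) p hlim
  have hle : eLpNorm p 2 volume ≤ ENNReal.ofReal (‖g - p‖ + ‖u‖ / 2) := by
    refine hfatou.trans (Filter.liminf_le_of_le (by isBoundedDefault) fun b hb => ?_)
    obtain ⟨n, hn⟩ := hb.exists
    refine hn.trans ?_
    rw [← Lp.enorm_def, ← ofReal_norm]
    exact ENNReal.ofReal_le_ofReal (hv' n)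
  rw [Lp.norm_def]
  exact ENNReal.toReal_le_of_le_ofReal (by positivity) hle

/-! ### The exponential weight. -/

/-- A positive bounded weight on `{ξ₀² > d}` whose logarithmic derivative along the shear flow is
`σ A ξ₀² / ((1 + ξ₁²)(ξ₀² + d))`, up to a bounded error. -/
def expWeight (c d σ A : ℝ) (ξ : Space) : ℝ :=
  Real.smoothTransition (ξ 0 ^ 2 - d) *
    (Real.exp (σ * A * Real.arctan (ξ 1) * (ξ 0 / (ξ 0 ^ 2 + d))) / (1 + c * ‖ξ‖ ^ 2))

/-- The logarithmic derivative of `expWeight` along the shear flow. -/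
def expWeightLogDeriv (c d σ A : ℝ) (ξ : Space) : ℝ :=
  σ * A / (1 + ξ 1 ^ 2) * (ξ 0 ^ 2 / (ξ 0 ^ 2 + d)) -
    c * (2 * (ξ 0 * ξ 1)) / (1 + c * ‖ξ‖ ^ 2)

section ExpWeight

variable {c d σ A : ℝ}

theorem contDiff_expWeight (hc : 0 < c) (hd : 0 < d) (σ A : ℝ) :
    ContDiff ℝ (⊤ : ℕ∞) (expWeight c d σ A) := by
  have h : ContDiff ℝ (⊤ : ℕ∞) (fun ξ : Space => ‖ξ‖ ^ 2) := contDiff_norm_sq ℝ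
  have hco (i : Fin 3) : ContDiff ℝ (⊤ : ℕ∞) (fun ξ : Space => ξ i) :=
    (EuclideanSpace.proj i : Space →L[ℝ] ℝ).contDiff
  refine (Real.smoothTransition.contDiff.comp (((hco 0).pow 2).sub contDiff_const)).mul
    (((contDiff_const.mul (hco 1).arctan).mul
      ((hco 0).div (((hco 0).pow 2).add contDiff_const) fun ξ => by positivity)).exp.div
      (contDiff_const.add (contDiff_const.mul h)) fun ξ => by positivity)

theorem expWeight_nonneg (hc : 0 < c) (ξ : Space) : 0 ≤ expWeight c d σ A ξ := by
  have := Real.smoothTransition.nonneg (ξ 0 ^ 2 - d)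
  unfold expWeight; positivity

theorem expWeight_pos (hc : 0 < c) {ξ : Space} (h : d < ξ 0 ^ 2) : 0 < expWeight c d σ A ξ := by
  have := Real.smoothTransition.pos_of_pos (sub_pos.2 h)
  unfold expWeight; positivity

theorem expWeight_eq_zero {ξ : Space} (h : ξ 0 ^ 2 ≤ d) : expWeight c d σ A ξ = 0 := by
  simp [expWeight, Real.smoothTransition.zero_of_nonpos (sub_nonpos.2 h)]

/-- The shear fixes `ξ₀`, so the cutoff and the factor `ξ₀/(ξ₀²+d)` are constants for `D`; only the
arctangent and `|ξ|²` are differentiated. That factor is a smooth substitute for `1/ξ₀`, cancelling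
the `ξ₀` in `D`. -/
theorem shearDeriv_expWeight (hc : 0 < c) (hd : 0 < d) (ξ : Space) :
    shearDeriv (fun η => (expWeight c d σ A η : ℂ)) ξ =
      ((expWeight c d σ A ξ * expWeightLogDeriv c d σ A ξ : ℝ) : ℂ) := by
  refine shearDeriv_ofReal_eq (contDiff_expWeight hc hd σ A) ?_
  have h1 := ((hasDerivAt_normSq_shear ξ).const_mul c).const_add 1
  have h2 : HasDerivAt (fun t => shear t ξ 1) (ξ 0) 0 := by
    simp only [(shear_coords _ ξ).2.1]
    simpa using (((hasDerivAt_id (0 : ℝ)).mul_const (ξ 0)).const_add (ξ 1))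
  have h3 := (((h2.arctan.const_mul (σ * A)).mul_const (ξ 0 / (ξ 0 ^ 2 + d))).exp.div h1
    (by simp only [shear_zero]; positivity)).const_mul (Real.smoothTransition (ξ 0 ^ 2 - d))
  simp only [expWeight, (shear_coords _ ξ).1] at h3 ⊢
  refine h3.congr_deriv ?_
  simp only [shear_zero, expWeightLogDeriv]
  have : 1 + c * ‖ξ‖ ^ 2 ≠ 0 := by positivity
  have : 1 + ξ 1 ^ 2 ≠ 0 := by positivity
  have : ξ 0 ^ 2 + d ≠ 0 := by positivity
  field_simp

/-- The denominator `1 + c|ξ|²` of the weight serves this bound: it makes the weight times `c|ξ|²w`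
square integrable, at the price of an error at most one in the logarithmic derivative. -/
theorem expWeight_mul_le (hc : 0 < c) (hd : 0 < d) (hσ : |σ| ≤ 1) (hA : 0 ≤ A)
    (hd1 : d ≤ 1) (ξ : Space) :
    expWeight c d σ A ξ * (1 + c * ‖ξ‖ ^ 2) ≤ Real.exp (2 * A / d) := by
  have e : expWeight c d σ A ξ * (1 + c * ‖ξ‖ ^ 2) = Real.smoothTransition (ξ 0 ^ 2 - d) *
      Real.exp (σ * A * Real.arctan (ξ 1) * (ξ 0 / (ξ 0 ^ 2 + d))) := by
    have : 1 + c * ‖ξ‖ ^ 2 ≠ 0 := by positivity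
    unfold expWeight; field_simp
  rw [e]
  refine (mul_le_of_le_one_left (Real.exp_pos _).le (Real.smoothTransition.le_one _)).trans ?_
  refine Real.exp_le_exp.2 ((le_abs_self _).trans ?_)
  have h1 : |Real.arctan (ξ 1)| ≤ 2 := by
    have := Real.arctan_lt_pi_div_two (ξ 1)
    have := Real.neg_pi_div_two_lt_arctan (ξ 1)
    have := Real.pi_lt_four
    rw [abs_le]; constructor <;> linarith
  -- From `d|ξ₀| ≤ ξ₀² + d²/4` and `d² ≤ d`; this is where `d ≤ 1` enters.
  have h2 : |ξ 0 / (ξ 0 ^ 2 + d)| ≤ 1 / d := by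
    have hp : 0 < ξ 0 ^ 2 + d := by positivity
    rw [abs_div, abs_of_pos hp, div_le_div_iff₀ hp hd]
    have h3 : |ξ 0| ^ 2 = ξ 0 ^ 2 := sq_abs _
    nlinarith [sq_nonneg (|ξ 0| - d / 2)]
  rw [abs_mul, abs_mul, abs_mul, abs_of_nonneg hA]
  calc |σ| * A * |Real.arctan (ξ 1)| * |ξ 0 / (ξ 0 ^ 2 + d)| ≤ 1 * A * 2 * (1 / d) := by gcongr
    _ = 2 * A / d := by ring

theorem abs_shear_normSq_div_le (hc : 0 < c) (ξ : Space) :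
    |c * (2 * (ξ 0 * ξ 1)) / (1 + c * ‖ξ‖ ^ 2)| ≤ 1 := by
  have hp : 0 < 1 + c * ‖ξ‖ ^ 2 := by positivity
  rw [abs_div, abs_mul, abs_of_pos hp, abs_of_pos hc, div_le_one hp]
  nlinarith [abs_two_mul_coords_le ξ]

theorem abs_expWeightLogDeriv_le (hc : 0 < c) (hd : 0 < d) (hσ : |σ| ≤ 1) (hA : 0 ≤ A) (ξ : Space) :
    |expWeightLogDeriv c d σ A ξ| ≤ A + 1 := by
  unfold expWeightLogDeriv
  refine (abs_sub _ _).trans (add_le_add ?_ (abs_shear_normSq_div_le hc ξ))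
  have hp : 0 < ξ 0 ^ 2 + d := by positivity
  have hp' : 0 < 1 + ξ 1 ^ 2 := by positivity
  rw [abs_mul, abs_div, abs_mul, abs_of_nonneg hA, abs_of_pos hp', abs_div, abs_of_pos hp,
    abs_of_nonneg (sq_nonneg (ξ 0))]
  have h1 : |σ| * A / (1 + ξ 1 ^ 2) ≤ A := by
    rw [div_le_iff₀ hp']
    nlinarith [mul_nonneg hA (sq_nonneg (ξ 1)), abs_nonneg σ]
  have h2 : ξ 0 ^ 2 / (ξ 0 ^ 2 + d) ≤ 1 := by
    rw [div_le_one hp]; linarith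
  calc _ ≤ A * 1 := by gcongr
    _ = A := mul_one A

/-- With `t = 1 + ξ₁²`, viscosity gives `ct - c` and the arctangent at least `B²/(4ct)`, because
`ξ₀² > d` makes `ξ₀²/(ξ₀²+d)` at least `1/2`. Their sum is at least `B - c` by the inequality of
arithmetic and geometric means, which dictates `A = B²/(2c)`; the last `1` pays for the denominator
of the weight. -/
theorem le_sigma_mul_expWeightLogDeriv (hc : 0 < c) (hd : 0 < d) (hσ : σ ^ 2 = 1) {B : ℝ}
    {ξ : Space} (h : d < ξ 0 ^ 2) :
    B - c - 1 ≤ c * ‖ξ‖ ^ 2 + σ * expWeightLogDeriv c d σ (B ^ 2 / (2 * c)) ξ := by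
  have hσ1 : |σ| = 1 := by
    rw [← abs_one, ← sq_eq_sq_iff_abs_eq_abs, hσ, one_pow]
  set q := c * (2 * (ξ 0 * ξ 1)) / (1 + c * ‖ξ‖ ^ 2) with hq
  have h1 : -1 ≤ -(σ * q) := by
    have h2 : |σ * q| ≤ 1 := by
      rw [abs_mul, hσ1, one_mul]; exact abs_shear_normSq_div_le hc ξ
    linarith [(abs_le.1 h2).2]
  have hp : 0 < ξ 0 ^ 2 + d := by positivity
  have h2 : 1 / 2 ≤ ξ 0 ^ 2 / (ξ 0 ^ 2 + d) := by
    rw [div_le_div_iff₀ two_pos hp]; linarith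
  have h3 : c * ξ 1 ^ 2 ≤ c * ‖ξ‖ ^ 2 := by
    rw [norm_sq_eq_coords]; gcongr; nlinarith [sq_nonneg (ξ 0), sq_nonneg (ξ 2)]
  set t := 1 + ξ 1 ^ 2 with ht
  have htp : 0 < t := by positivity
  have h4 : B ≤ c * t + B ^ 2 / (2 * c) / t * (1 / 2) := by
    have e : c * t + B ^ 2 / (2 * c) / t * (1 / 2) - B = (2 * c * t - B) ^ 2 / (4 * c * t) := by
      field_simp
      ring
    have : 0 ≤ (2 * c * t - B) ^ 2 / (4 * c * t) := by positivity
    linarith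
  have h5 : B ^ 2 / (2 * c) / t * (1 / 2) ≤ B ^ 2 / (2 * c) / t * (ξ 0 ^ 2 / (ξ 0 ^ 2 + d)) := by
    gcongr
  have e : σ * expWeightLogDeriv c d σ (B ^ 2 / (2 * c)) ξ =
      σ ^ 2 * (B ^ 2 / (2 * c) / t * (ξ 0 ^ 2 / (ξ 0 ^ 2 + d))) - σ * q := by
    unfold expWeightLogDeriv
    rw [← hq, ← ht]
    ring
  rw [e, hσ]
  have : c * t = c + c * ξ 1 ^ 2 := by rw [ht]; ring
  linarith

end ExpWeight

/-! ### Uniqueness for the eigenvalue system. -/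

theorem volume_coord_zero : volume {ξ : Space | ξ 0 = 0} = 0 := by
  have h := Measure.addHaar_submodule (volume : Measure Space)
    (LinearMap.ker ((EuclideanSpace.proj 0 : Space →L[ℝ] ℝ) : Space →ₗ[ℝ] ℝ)) ?_
  · exact h
  · intro h
    have : (EuclideanSpace.single 0 1 : Space) ∈
        LinearMap.ker ((EuclideanSpace.proj 0 : Space →L[ℝ] ℝ) : Space →ₗ[ℝ] ℝ) := by
      rw [h]; trivial
    simp at this

/-- The system `ξ₀ ∂₁ w = ± (c|ξ|² w + b)` with `b` bounded by `w` has no nonzero solution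
in `L²`. -/
theorem eq_zero_of_hasWeakShearDeriv {ι : Type*} [Fintype ι] {c K σ : ℝ} (hc : 0 < c) (hK : 0 ≤ K)
    (hσ : σ ^ 2 = 1) {w b : ι → L2}
    (hb : ∀ i, ∀ᵐ ξ, ‖b i ξ‖ ≤ K * ∑ j, ‖w j ξ‖)
    (h : ∀ i, HasWeakShearDeriv (w i)
      fun ξ => (σ : ℂ) * (((c * ‖ξ‖ ^ 2 : ℝ) : ℂ) * w i ξ + b i ξ)) (i : ι) : w i = 0 := by
  have hσ1 : |σ| = 1 := by
    rw [← abs_one, ← sq_eq_sq_iff_abs_eq_abs, hσ, one_pow]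
  -- Chosen so that `B - c - 1 = K * Fintype.card ι + 1`: enough to absorb `b` and leave one copy of
  -- `∑ ‖w‖²`.
  set B : ℝ := K * Fintype.card ι + 2 + c with hB
  set A : ℝ := B ^ 2 / (2 * c) with hA
  have hA0 : 0 ≤ A := by positivity
  have hbsum : ∀ᵐ ξ, ∑ j, ‖w j ξ‖ * ‖b j ξ‖ ≤ K * Fintype.card ι * ∑ j, ‖w j ξ‖ ^ 2 := by
    filter_upwards [ae_all_iff.2 hb] with ξ hξ
    calc ∑ j, ‖w j ξ‖ * ‖b j ξ‖ ≤ ∑ j, ‖w j ξ‖ * (K * ∑ j, ‖w j ξ‖) := by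
          gcongr with j; exact hξ j
      _ = K * (∑ j, ‖w j ξ‖) ^ 2 := by rw [← Finset.sum_mul]; ring
      _ ≤ K * (Fintype.card ι * ∑ j, ‖w j ξ‖ ^ 2) := by
          gcongr
          simpa using sq_sum_le_card_mul_sum_sq (s := Finset.univ) (f := fun j => ‖w j ξ‖)
      _ = _ := by ring
  have key : ∀ d : ℝ, 0 < d → d ≤ 1 → ∀ᵐ ξ, d < ξ 0 ^ 2 → ∑ j, ‖w j ξ‖ ^ 2 = 0 := by
    intro d hd hd1
    set m := expWeight c d σ A with hm
    set q := expWeightLogDeriv c d σ A with hq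
    set M := Real.exp (2 * A / d)
    have hM : 0 < M := Real.exp_pos _
    have hm0 : ∀ ξ, 0 ≤ m ξ := expWeight_nonneg hc
    have hmM : ∀ ξ, m ξ * (1 + c * ‖ξ‖ ^ 2) ≤ M := expWeight_mul_le hc hd hσ1.le hA0 hd1
    have hma : ∀ ξ, m ξ * (c * ‖ξ‖ ^ 2) ≤ M := fun ξ => by nlinarith [hmM ξ, hm0 ξ]
    have hmM' : ∀ ξ, m ξ ≤ M := fun ξ => by
      have : 0 ≤ m ξ * (c * ‖ξ‖ ^ 2) := mul_nonneg (hm0 ξ) (by positivity)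
      nlinarith [hmM ξ]
    have hqA : ∀ ξ, |q ξ| ≤ A + 1 := abs_expWeightLogDeriv_le hc hd hσ1.le hA0
    have hsm : ContDiff ℝ (⊤ : ℕ∞) (fun ξ => (m ξ : ℂ)) :=
      Complex.ofRealCLM.contDiff.comp (contDiff_expWeight hc hd σ A)
    have hD : ∀ ξ, shearDeriv (fun η => (m η : ℂ)) ξ = ((m ξ * q ξ : ℝ) : ℂ) :=
      shearDeriv_expWeight hc hd
    have hb1 : ∀ ξ, ‖(m ξ : ℂ)‖ ≤ M := fun ξ => by
      rw [Complex.norm_real, Real.norm_eq_abs, abs_of_nonneg (hm0 ξ)]; exact hmM' ξ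
    have hb2 : ∀ ξ, ‖(m ξ : ℂ) * ((c * ‖ξ‖ ^ 2 : ℝ) : ℂ)‖ ≤ M := fun ξ => by
      rw [← Complex.ofReal_mul, Complex.norm_real, Real.norm_eq_abs,
        abs_of_nonneg (mul_nonneg (hm0 ξ) (by positivity))]
      exact hma ξ
    have hb3 : ∀ ξ, ‖shearDeriv (fun η => (m η : ℂ)) ξ‖ ≤ M * (A + 1) := fun ξ => by
      rw [hD, Complex.norm_real, Real.norm_eq_abs, abs_mul, abs_of_nonneg (hm0 ξ)]
      gcongr
      · exact hmM' ξ
      · exact hqA ξ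
    have hcont2 : Continuous (fun ξ : Space => (m ξ : ℂ) * ((c * ‖ξ‖ ^ 2 : ℝ) : ℂ)) :=
      hsm.continuous.mul (by fun_prop)
    choose v hv using fun j => exists_mul_L2 hsm.continuous hb1 (w j)
    choose v1 hv1 using fun j => exists_mul_L2 hcont2 hb2 (w j)
    choose v2 hv2 using fun j => exists_mul_L2 hsm.continuous hb1 (b j)
    choose v3 hv3 using fun j => exists_mul_L2 (continuous_shearDeriv hsm) hb3 (w j)
    set G : ι → L2 := fun j => (σ : ℂ) • (v1 j + v2 j) + v3 j with hG
    have hGae : ∀ j, G j =ᵐ[volume] fun ξ =>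
        (m ξ : ℂ) * ((σ : ℂ) * (((c * ‖ξ‖ ^ 2 : ℝ) : ℂ) * w j ξ + b j ξ)) +
          shearDeriv (fun η => (m η : ℂ)) ξ * w j ξ := by
      intro j
      filter_upwards [hv1 j, hv2 j, hv3 j, Lp.coeFn_add (v1 j) (v2 j),
        Lp.coeFn_smul (σ : ℂ) (v1 j + v2 j), Lp.coeFn_add ((σ : ℂ) • (v1 j + v2 j)) (v3 j)]
        with ξ h1 h2 h3 h4 h5 h6
      rw [hG, h6, Pi.add_apply, h5, Pi.smul_apply, h4, Pi.add_apply, h1, h2, h3, smul_eq_mul]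
      ring
    have hweak : ∀ j, HasWeakShearDeriv (v j) (G j) := by
      intro j
      have hloc : LocallyIntegrable
          fun ξ => (σ : ℂ) * (((c * ‖ξ‖ ^ 2 : ℝ) : ℂ) * w j ξ + b j ξ) :=
        (((locallyIntegrable_L2 (w j)).continuous_mul
          (g := fun ξ : Space => ((c * ‖ξ‖ ^ 2 : ℝ) : ℂ)) (by fun_prop)).add
          (locallyIntegrable_L2 (b j))).smul (σ : ℂ)
      exact ((h j).mul (locallyIntegrable_L2 (w j)) hloc hsm).congr (hv j).symm (hGae j).symm
    -- The energy density: by skew-symmetry its integral vanishes, while the weight makes it bounded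
    -- below by `m²∑‖w‖²`.
    set Q : Space → ℝ := fun ξ => ∑ j, σ * (G j ξ * star (v j ξ)).re with hQ
    have hQint : Integrable Q :=
      integrable_finsetSum _ fun j _ => (integrable_re_mul_star (v j) (G j)).const_mul σ
    have hQ0 : ∫ ξ, Q ξ = 0 := by
      rw [hQ, integral_finsetSum _ fun j _ => (integrable_re_mul_star (v j) (G j)).const_mul σ]
      refine Finset.sum_eq_zero fun j _ => ?_
      rw [integral_const_mul, ← re_inner_eq, re_inner_weakShearDeriv_eq_zero (hweak j), mul_zero]
    have hQge : ∀ᵐ ξ, m ξ ^ 2 * ∑ j, ‖w j ξ‖ ^ 2 ≤ Q ξ := by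
      filter_upwards [ae_all_iff.2 hv, ae_all_iff.2 hGae, hbsum] with ξ h1 h2 h3
      have e1 : ∀ j, σ * (G j ξ * star (v j ξ)).re =
          m ξ ^ 2 * ((c * ‖ξ‖ ^ 2 + σ * q ξ) * ‖w j ξ‖ ^ 2 + (b j ξ * star (w j ξ)).re) := by
        intro j
        rw [h1, h2, hD]
        have e2 : ((m ξ : ℂ) * ((σ : ℂ) * (((c * ‖ξ‖ ^ 2 : ℝ) : ℂ) * w j ξ + b j ξ)) +
            ((m ξ * q ξ : ℝ) : ℂ) * w j ξ) * star ((m ξ : ℂ) * w j ξ) =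
            ((m ξ * σ * (c * ‖ξ‖ ^ 2) + m ξ * q ξ : ℝ) : ℂ) * w j ξ * star ((m ξ : ℂ) * w j ξ) +
              ((m ξ ^ 2 * σ : ℝ) : ℂ) * (b j ξ * star (w j ξ)) := by
          have : star (m ξ : ℂ) = m ξ := Complex.conj_ofReal _
          rw [star_mul', this]
          push_cast
          ring
        rw [e2, Complex.add_re, re_ofReal_mul_mul_star, Complex.re_ofReal_mul]
        -- The factor `σ` in `Q` meets the one in the equation; `σ² = 1` gives the viscous term a
        -- positive sign in both cases.
        linear_combination (m ξ ^ 2 * (c * ‖ξ‖ ^ 2) * ‖w j ξ‖ ^ 2 +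
          m ξ ^ 2 * (b j ξ * star (w j ξ)).re) * hσ
      have e3 : Q ξ = m ξ ^ 2 * ((c * ‖ξ‖ ^ 2 + σ * q ξ) * ∑ j, ‖w j ξ‖ ^ 2 +
          ∑ j, (b j ξ * star (w j ξ)).re) := by
        simp only [hQ, e1]
        rw [← Finset.mul_sum, Finset.sum_add_distrib, Finset.mul_sum]
      rw [e3]
      rcases le_or_gt (ξ 0 ^ 2) d with hle | hlt
      · rw [hm, expWeight_eq_zero hle]; simp
      · have e4 : -(K * Fintype.card ι * ∑ j, ‖w j ξ‖ ^ 2) ≤ ∑ j, (b j ξ * star (w j ξ)).re := by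
          rw [neg_le, ← Finset.sum_neg_distrib]
          refine le_trans (Finset.sum_le_sum fun j _ => ?_) h3
          refine (neg_le_abs _).trans ((Complex.abs_re_le_norm _).trans_eq ?_)
          rw [norm_mul, norm_star, mul_comm]
        have e5 := le_sigma_mul_expWeightLogDeriv hc hd hσ (B := B) hlt
        have e6 : K * Fintype.card ι + 1 ≤ c * ‖ξ‖ ^ 2 + σ * q ξ := by
          have e8 : K * Fintype.card ι + 1 = B - c - 1 := by rw [hB]; ring
          rw [e8]
          exact e5
        have e7 : 0 ≤ ∑ j, ‖w j ξ‖ ^ 2 := by positivity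
        refine mul_le_mul_of_nonneg_left ?_ (sq_nonneg _)
        nlinarith [mul_le_mul_of_nonneg_right e6 e7]
    have hQnn : 0 ≤ᵐ[volume] Q := by
      filter_upwards [hQge] with ξ hξ
      refine le_trans ?_ hξ
      change (0 : ℝ) ≤ _
      positivity
    have hQz := (integral_eq_zero_iff_of_nonneg_ae hQnn hQint).1 hQ0
    filter_upwards [hQge, hQz] with ξ h1 h2 hlt
    rw [h2, Pi.zero_apply] at h1
    have h3 : 0 < m ξ ^ 2 := pow_pos (expWeight_pos hc hlt) 2
    have h4 : 0 ≤ ∑ j, ‖w j ξ‖ ^ 2 := by positivity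
    nlinarith
  rw [Lp.eq_zero_iff_ae_eq_zero]
  have hall := ae_all_iff.2 fun n : ℕ => key (1 / ((n : ℝ) + 1)) (by positivity)
    ((div_le_one (by positivity)).2 (by linarith [(Nat.cast_nonneg n : (0 : ℝ) ≤ n)]))
  -- The plane `ξ₀ = 0`, where the shear is stationary and the argument says nothing, is a null set;
  -- its complement is exhausted by `ξ₀² > 1/(n+1)`.
  have hne : ∀ᵐ ξ : Space, ξ 0 ≠ 0 := by
    rw [ae_iff]; simpa using volume_coord_zero
  filter_upwards [hall, hne] with ξ h1 h2
  obtain ⟨n, hn⟩ := exists_nat_one_div_lt (show 0 < ξ 0 ^ 2 by positivity)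
  have h3 := (Finset.sum_eq_zero_iff_of_nonneg fun j _ => sq_nonneg ‖w j ξ‖).1 (h1 n hn) i
    (Finset.mem_univ i)
  simpa using h3

/-! ### The operators on the Fourier side -/

theorem toDistr_apply (u : L2) (ψ : 𝓢(Space, ℂ)) : toDistr u ψ = ∫ ξ, ψ ξ * u ξ :=
  Lp.toTemperedDistribution_apply u ψ

theorem toDistr_fourier_apply (u : L2) (ψ : 𝓢(Space, ℂ)) :
    toDistr (𝓕 u) ψ = toDistr u (𝓕 ψ) := by
  have h : toDistr (𝓕 u) = 𝓕 (toDistr u) := (Lp.fourier_toTemperedDistribution_eq u).symm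
  rw [h]
  rfl

/-- The class in `L²` of a Schwartz function. -/
abbrev toL2 (χ : 𝓢(Space, ℂ)) : L2 := χ.toLp 2 volume

theorem toDistr_toL2 (χ : 𝓢(Space, ℂ)) :
    toDistr (toL2 χ) = χ.toTemperedDistributionCLM Space ℂ volume :=
  Lp.toTemperedDistribution_toLp_eq χ

theorem toDistr_toL2_apply (χ ψ : 𝓢(Space, ℂ)) : toDistr (toL2 χ) ψ = ∫ ξ, ψ ξ * χ ξ := by
  rw [toDistr_toL2]
  exact SchwartzMap.toTemperedDistributionCLM_apply_apply volume χ ψ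

theorem toDistr_transportL2 (u : transportL2.domain) :
    toDistr (transportL2 u) = (TemperedDistribution.smulLeftCLM ℂ
      (fun p : Space => ((p 1 : ℝ) : ℂ)) ∘L
      LineDeriv.lineDerivOpCLM ℂ 𝓢'(Space, ℂ) (EuclideanSpace.single 0 1 : Space))
        (toDistr (u : L2)) :=
  toDistr_realization _ u

theorem toDistr_laplacianL2 (u : laplacianL2.domain) :
    toDistr (laplacianL2 u) = LineDeriv.laplacianCLM ℂ Space 𝓢'(Space, ℂ) (toDistr (u : L2)) :=
  toDistr_realization _ u

theorem hasTemperateGrowth_coord (i : Fin 3) :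
    Function.HasTemperateGrowth (fun p : Space => ((p i : ℝ) : ℂ)) :=
  (Complex.ofRealCLM ∘L (EuclideanSpace.proj i : Space →L[ℝ] ℝ)).hasTemperateGrowth

/-- Multiplication of Schwartz functions by a coordinate. -/
def coordMul (i : Fin 3) : 𝓢(Space, ℂ) →L[ℂ] 𝓢(Space, ℂ) :=
  SchwartzMap.smulLeftCLM ℂ (fun p : Space => ((p i : ℝ) : ℂ))

theorem coordMul_apply (i : Fin 3) (χ : 𝓢(Space, ℂ)) (ξ : Space) :
    coordMul i χ ξ = (ξ i : ℂ) * χ ξ :=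
  SchwartzMap.smulLeftCLM_apply_apply (hasTemperateGrowth_coord i) χ ξ

/-- Partial derivatives of Schwartz functions. -/
def coordDeriv (i : Fin 3) : 𝓢(Space, ℂ) →L[ℂ] 𝓢(Space, ℂ) :=
  LineDeriv.lineDerivOpCLM ℂ 𝓢(Space, ℂ) (EuclideanSpace.single i 1 : Space)

theorem smulLeftCLM_inner_single (i : Fin 3) (χ : 𝓢(Space, ℂ)) :
    SchwartzMap.smulLeftCLM ℂ (fun p : Space => inner ℝ p (EuclideanSpace.single i 1)) χ =
      coordMul i χ := by
  have h : Function.HasTemperateGrowth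
      (fun p : Space => inner ℝ p (EuclideanSpace.single i (1 : ℝ))) := by fun_prop
  ext ξ
  rw [SchwartzMap.smulLeftCLM_apply_apply h, coordMul_apply]
  simp [EuclideanSpace.inner_single_right]

theorem coordDeriv_fourier (i : Fin 3) (χ : 𝓢(Space, ℂ)) :
    coordDeriv i (𝓕 χ) = 𝓕 (-(2 * Real.pi * Complex.I) • coordMul i χ) := by
  rw [← smulLeftCLM_inner_single]
  exact SchwartzMap.lineDerivOp_fourier_eq χ _

theorem fourier_coordDeriv (i : Fin 3) (χ : 𝓢(Space, ℂ)) :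
    𝓕 (coordDeriv i χ) = (2 * Real.pi * Complex.I) • coordMul i (𝓕 χ) := by
  rw [← smulLeftCLM_inner_single]
  exact SchwartzMap.fourier_lineDerivOp_eq χ _

theorem two_pi_I_ne_zero : (2 * Real.pi * Complex.I : ℂ) ≠ 0 := by
  simp [Real.pi_ne_zero]

theorem coordMul_fourier (i : Fin 3) (χ : 𝓢(Space, ℂ)) :
    coordMul i (𝓕 χ) = (2 * Real.pi * Complex.I)⁻¹ • 𝓕 (coordDeriv i χ) := by
  rw [fourier_coordDeriv, smul_smul, inv_mul_cancel₀ two_pi_I_ne_zero, one_smul]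

theorem fourier_coordMul (i : Fin 3) (χ : 𝓢(Space, ℂ)) :
    𝓕 (coordMul i χ) = -(2 * Real.pi * Complex.I)⁻¹ • coordDeriv i (𝓕 χ) := by
  rw [coordDeriv_fourier, FourierTransform.fourier_smul, smul_smul, neg_mul_neg,
    inv_mul_cancel₀ two_pi_I_ne_zero, one_smul]

theorem coordMul_coordDeriv_apply (ψ : 𝓢(Space, ℂ)) (ξ : Space) :
    coordMul 0 (coordDeriv 1 ψ) ξ = shearDeriv ψ ξ := by
  rw [coordMul_apply]
  rfl

theorem coordDeriv_coordMul (ψ : 𝓢(Space, ℂ)) :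
    coordDeriv 1 (coordMul 0 ψ) = coordMul 0 (coordDeriv 1 ψ) := by
  ext ξ
  rw [coordMul_apply]
  change fderiv ℝ (coordMul 0 ψ) ξ (EuclideanSpace.single 1 1) =
    (ξ 0 : ℂ) * fderiv ℝ ψ ξ (EuclideanSpace.single 1 1)
  have h : (coordMul 0 ψ : Space → ℂ) = fun ξ => (ξ 0 : ℂ) * ψ ξ := funext (coordMul_apply 0 ψ)
  have h1 : HasFDerivAt (fun ξ : Space => (ξ 0 : ℂ))
      (Complex.ofRealCLM ∘L (EuclideanSpace.proj 0 : Space →L[ℝ] ℝ)) ξ :=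
    (Complex.ofRealCLM ∘L (EuclideanSpace.proj 0 : Space →L[ℝ] ℝ)).hasFDerivAt
  rw [h, fderiv_fun_mul h1.differentiableAt ψ.differentiable.differentiableAt, h1.fderiv]
  simp

/-- Each of the two operations contributes a factor `2πi` or its inverse; they cancel and only the
sign survives. -/
theorem coordDeriv_coordMul_fourier (ψ : 𝓢(Space, ℂ)) :
    coordDeriv 0 (coordMul 1 (𝓕 ψ)) = -𝓕 (coordMul 0 (coordDeriv 1 ψ)) := by
  rw [coordMul_fourier, map_smul, coordDeriv_fourier, FourierTransform.fourier_smul, smul_smul,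
    mul_neg, inv_mul_cancel₀ two_pi_I_ne_zero, neg_one_smul]

theorem fourier_coordMul_coordDeriv (χ : 𝓢(Space, ℂ)) :
    𝓕 (coordMul 1 (coordDeriv 0 χ)) = -coordMul 0 (coordDeriv 1 (𝓕 χ)) := by
  rw [fourier_coordMul, fourier_coordDeriv, map_smul, smul_smul, neg_mul,
    inv_mul_cancel₀ two_pi_I_ne_zero, neg_one_smul, coordDeriv_coordMul]

/-! ### Transport -/

theorem hasWeakShearDeriv_fourier_transportL2 (u : transportL2.domain) :
    HasWeakShearDeriv (𝓕 (u : L2) : L2) (-𝓕 (transportL2 u) : L2) := by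
  intro φ hφ hc
  set ψ : 𝓢(Space, ℂ) := hc.toSchwartzMap hφ with hψ
  -- Both the Fourier transform and `y∂ₓ` are moved to the test function by duality.
  have h1 : toDistr (𝓕 (transportL2 u)) ψ =
      toDistr (u : L2) (-coordDeriv 0 (coordMul 1 (𝓕 ψ))) := by
    rw [toDistr_fourier_apply, toDistr_transportL2]
    rfl
  rw [coordDeriv_coordMul_fourier, neg_neg, ← toDistr_fourier_apply, toDistr_apply,
    toDistr_apply] at h1
  have e1 : ∫ ξ, (𝓕 (u : L2) : L2) ξ * shearDeriv φ ξ =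
      ∫ ξ, coordMul 0 (coordDeriv 1 ψ) ξ * (𝓕 (u : L2) : L2) ξ := by
    refine integral_congr_ae (Filter.Eventually.of_forall fun ξ => ?_)
    simp only [coordMul_coordDeriv_apply]
    rw [mul_comm]
    rfl
  rw [e1, ← h1, ← integral_neg]
  refine integral_congr_ae ?_
  filter_upwards [Lp.coeFn_neg (𝓕 (transportL2 u) : L2)] with ξ hξ
  rw [hξ, Pi.neg_apply, neg_mul, neg_neg, mul_comm]
  rfl

theorem toDistr_toL2_transport (χ : 𝓢(Space, ℂ)) :
    toDistr (toL2 (coordMul 1 (coordDeriv 0 χ))) =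
      (TemperedDistribution.smulLeftCLM ℂ (fun p : Space => ((p 1 : ℝ) : ℂ)) ∘L
      LineDeriv.lineDerivOpCLM ℂ 𝓢'(Space, ℂ) (EuclideanSpace.single 0 1 : Space))
        (toDistr (toL2 χ)) := by
  have h : LineDeriv.lineDerivOpCLM ℂ 𝓢'(Space, ℂ) (EuclideanSpace.single 0 1 : Space)
      (toDistr (toL2 χ)) = toDistr (toL2 (coordDeriv 0 χ)) := by
    rw [toDistr_toL2, toDistr_toL2]
    exact TemperedDistribution.lineDerivOp_toTemperedDistributionCLM_eq χ _
  rw [ContinuousLinearMap.comp_apply, h]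
  ext ψ
  rw [TemperedDistribution.smulLeftCLM_apply_apply, toDistr_toL2_apply, toDistr_toL2_apply]
  refine integral_congr_ae (Filter.Eventually.of_forall fun ξ => ?_)
  simp only [SchwartzMap.smulLeftCLM_apply_apply hasTemperateGrowth_y, smul_eq_mul, coordMul_apply]
  rw [mul_left_comm, mul_assoc]

theorem toL2_mem_transportL2_domain (χ : 𝓢(Space, ℂ)) : toL2 χ ∈ transportL2.domain :=
  ⟨_, toDistr_toL2_transport χ⟩

theorem transportL2_toL2 (χ : 𝓢(Space, ℂ)) :
    transportL2 ⟨toL2 χ, toL2_mem_transportL2_domain χ⟩ =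
      toL2 (coordMul 1 (coordDeriv 0 χ)) := by
  refine toDistr_injective ?_
  rw [toDistr_toL2_transport, toDistr_transportL2]

/-! ### Laplacian -/

theorem laplacian_fourier (ψ : 𝓢(Space, ℂ)) :
    Δ (𝓕 ψ) = 𝓕 ((-(4 * Real.pi ^ 2) : ℂ) • ∑ i, coordMul i (coordMul i ψ)) := by
  have h1 : Δ (𝓕 ψ) = ∑ i, coordDeriv i (coordDeriv i (𝓕 ψ)) := by
    rw [SchwartzMap.laplacian_eq_sum (EuclideanSpace.basisFun (Fin 3) ℝ)]
    simp only [EuclideanSpace.basisFun_apply]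
    rfl
  have h2 (i : Fin 3) : coordDeriv i (coordDeriv i (𝓕 ψ)) =
      fourierCLM ℂ 𝓢(Space, ℂ) ((-(4 * Real.pi ^ 2) : ℂ) • coordMul i (coordMul i ψ)) := by
    rw [coordDeriv_fourier, coordDeriv_fourier, map_smul, smul_smul, fourierCLM_apply]
    congr 2
    linear_combination (4 * Real.pi ^ 2 : ℂ) * Complex.I_mul_I
  rw [h1]
  simp only [h2]
  rw [← map_sum, ← Finset.smul_sum, fourierCLM_apply]

theorem toDistr_fourier_laplacianL2_apply (u : laplacianL2.domain) (ψ : 𝓢(Space, ℂ)) :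
    toDistr (𝓕 (laplacianL2 u)) ψ =
      ∫ ξ, -((4 * Real.pi ^ 2 * ‖ξ‖ ^ 2 : ℝ) : ℂ) * ψ ξ * (𝓕 (u : L2) : L2) ξ := by
  have h1 : toDistr (𝓕 (laplacianL2 u)) ψ = toDistr (u : L2) (Δ (𝓕 ψ)) := by
    rw [toDistr_fourier_apply, toDistr_laplacianL2, TemperedDistribution.laplacianCLM_apply,
      TemperedDistribution.laplacian_apply_apply]
  rw [h1, laplacian_fourier, ← toDistr_fourier_apply, toDistr_apply]
  refine integral_congr_ae (Filter.Eventually.of_forall fun ξ => ?_)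
  simp only [Fin.sum_univ_three, smul_apply, add_apply, coordMul_apply,
    norm_sq_eq_coords, smul_eq_mul]
  push_cast
  ring

theorem fourier_laplacianL2 (u : laplacianL2.domain) :
    (𝓕 (laplacianL2 u) : L2) =ᵐ[volume]
      fun ξ => -((4 * Real.pi ^ 2 * ‖ξ‖ ^ 2 : ℝ) : ℂ) * (𝓕 (u : L2) : L2) ξ := by
  refine ae_eq_of_integral_contDiff_smul_eq (locallyIntegrable_L2 _)
    ((locallyIntegrable_L2 _).continuous_mul (by fun_prop)) fun g hg hgc => ?_
  have hg1 : ContDiff ℝ (⊤ : ℕ∞) (fun ξ => (g ξ : ℂ)) := Complex.ofRealCLM.contDiff.comp hg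
  have hg2 : HasCompactSupport (fun ξ => (g ξ : ℂ)) :=
    hgc.comp_left (g := Complex.ofReal) Complex.ofReal_zero
  set ψ : 𝓢(Space, ℂ) := hg2.toSchwartzMap hg1
  have h1 := toDistr_fourier_laplacianL2_apply u ψ
  rw [toDistr_apply] at h1
  refine Eq.trans ?_ (h1.trans ?_)
  · exact integral_congr_ae (Filter.Eventually.of_forall fun ξ => Complex.real_smul)
  · refine integral_congr_ae (Filter.Eventually.of_forall fun ξ => ?_)
    simp only [Complex.real_smul]
    rw [mul_left_comm, mul_assoc]
    rfl

theorem toDistr_toL2_laplacian (χ : 𝓢(Space, ℂ)) :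
    toDistr (toL2 (Δ χ)) =
      LineDeriv.laplacianCLM ℂ Space 𝓢'(Space, ℂ) (toDistr (toL2 χ)) := by
  rw [toDistr_toL2, toDistr_toL2, TemperedDistribution.laplacianCLM_apply,
    TemperedDistribution.laplacian_toTemperedDistributionCLM_eq]

theorem toL2_mem_laplacianL2_domain (χ : 𝓢(Space, ℂ)) : toL2 χ ∈ laplacianL2.domain :=
  ⟨_, toDistr_toL2_laplacian χ⟩

/-! ### Closedness -/

theorem fourier_sub_L2 (u v : L2) : (𝓕 (u - v) : L2) = 𝓕 u - 𝓕 v :=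
  (Lp.fourierTransformₗᵢ Space ℂ).map_sub u v

theorem laplacianL2_toL2 (χ : 𝓢(Space, ℂ)) :
    laplacianL2 ⟨toL2 χ, toL2_mem_laplacianL2_domain χ⟩ = toL2 (Δ χ) := by
  refine toDistr_injective ?_
  rw [toDistr_toL2_laplacian, toDistr_laplacianL2]

/-- Realizations are closed: `L²` embeds continuously into the tempered distributions, where `A` is
continuous and limits are unique. -/
theorem toDistr_eq_of_tendsto (A : 𝓢'(Space, ℂ) →L[ℂ] 𝓢'(Space, ℂ)) {u w : ℕ → L2} {u' w' : L2}
    (h : ∀ n, toDistr (w n) = A (toDistr (u n)))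
    (hu : Filter.Tendsto u Filter.atTop (nhds u')) (hw : Filter.Tendsto w Filter.atTop (nhds w')) :
    toDistr w' = A (toDistr u') := by
  have hc : Continuous toDistr :=
    (Lp.toTemperedDistributionCLM (E := Space) ℂ volume 2).continuous
  have h1 := (hc.tendsto w').comp hw
  have h2 := ((A.continuous.comp hc).tendsto u').comp hu
  refine tendsto_nhds_unique h1 (h2.congr fun n => ?_)
  exact (h n).symm

/-- The viscous estimate on the Fourier side, with `p` the transform of `-νΔu` and `g` that of
`-y∂ₓu`, carried back by Plancherel. -/
theorem norm_laplacianL2_le {ν : ℝ} (hν : 0 < ν) {u : L2} (h1 : u ∈ laplacianL2.domain)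
    (h2 : u ∈ transportL2.domain) :
    ‖(ν : ℂ) • laplacianL2 ⟨u, h1⟩‖ ≤
      ‖(ν : ℂ) • laplacianL2 ⟨u, h1⟩ - transportL2 ⟨u, h2⟩‖ + ‖u‖ / 2 := by
  have hc : 0 < 4 * Real.pi ^ 2 * ν := by positivity
  have hp : (𝓕 (-((ν : ℂ) • laplacianL2 ⟨u, h1⟩)) : L2) =ᵐ[volume]
      fun ξ => ((4 * Real.pi ^ 2 * ν * ‖ξ‖ ^ 2 : ℝ) : ℂ) * (𝓕 u : L2) ξ := by
    rw [FourierTransform.fourier_neg, FourierTransform.fourier_smul]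
    filter_upwards [Lp.coeFn_neg ((ν : ℂ) • 𝓕 (laplacianL2 ⟨u, h1⟩) : L2),
      Lp.coeFn_smul (ν : ℂ) (𝓕 (laplacianL2 ⟨u, h1⟩) : L2), fourier_laplacianL2 ⟨u, h1⟩]
      with ξ e1 e2 e3
    rw [e1, Pi.neg_apply, e2, Pi.smul_apply, e3, smul_eq_mul]
    push_cast
    ring
  have h := norm_le_of_hasWeakShearDeriv hc (hasWeakShearDeriv_fourier_transportL2 ⟨u, h2⟩) hp
  have e : -𝓕 (transportL2 ⟨u, h2⟩) - 𝓕 (-((ν : ℂ) • laplacianL2 ⟨u, h1⟩)) =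
      𝓕 ((ν : ℂ) • laplacianL2 ⟨u, h1⟩ - transportL2 ⟨u, h2⟩) := by
    rw [FourierTransform.fourier_neg, fourier_sub_L2]
    abel
  rw [e, Lp.norm_fourier_eq, Lp.norm_fourier_eq, Lp.norm_fourier_eq, norm_neg] at h
  exact h

/-- `νΔ - y∂ₓ` is closed on the domain of the `u` with `Δu, y∂ₓu ∈ L²`. -/
theorem exists_of_tendsto_viscous_transport {ν : ℝ} (hν : 0 < ν) {u : ℕ → L2} {u' h' : L2}
    (h1 : ∀ n, u n ∈ laplacianL2.domain) (h2 : ∀ n, u n ∈ transportL2.domain)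
    (hu : Filter.Tendsto u Filter.atTop (nhds u'))
    (hh : Filter.Tendsto (fun n => (ν : ℂ) • laplacianL2 ⟨u n, h1 n⟩ - transportL2 ⟨u n, h2 n⟩)
      Filter.atTop (nhds h')) :
    ∃ (h3 : u' ∈ laplacianL2.domain) (h4 : u' ∈ transportL2.domain),
      (ν : ℂ) • laplacianL2 ⟨u', h3⟩ - transportL2 ⟨u', h4⟩ = h' := by
  set s : ℕ → L2 := fun n => (ν : ℂ) • laplacianL2 ⟨u n, h1 n⟩ with hs
  set t : ℕ → L2 := fun n => transportL2 ⟨u n, h2 n⟩ with ht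
  have hν' : (ν : ℂ) ≠ 0 := Complex.ofReal_ne_zero.2 hν.ne'
  -- The separate control of `νΔ`, applied to differences, makes `νΔuₙ` a Cauchy sequence; the
  -- transport term then converges as a difference.
  have hdist : ∀ n m, dist (s n) (s m) ≤ dist (s n - t n) (s m - t m) + dist (u n) (u m) / 2 := by
    intro n m
    have e := norm_laplacianL2_le hν (sub_mem (h1 n) (h1 m)) (sub_mem (h2 n) (h2 m))
    have e1 : laplacianL2 ⟨u n - u m, sub_mem (h1 n) (h1 m)⟩ =
        laplacianL2 ⟨u n, h1 n⟩ - laplacianL2 ⟨u m, h1 m⟩ :=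
      laplacianL2.map_sub ⟨u n, h1 n⟩ ⟨u m, h1 m⟩
    have e2 : transportL2 ⟨u n - u m, sub_mem (h2 n) (h2 m)⟩ = t n - t m :=
      transportL2.map_sub ⟨u n, h2 n⟩ ⟨u m, h2 m⟩
    rw [e1, e2, smul_sub] at e
    rw [dist_eq_norm, dist_eq_norm, dist_eq_norm, sub_sub_sub_comm]
    exact e
  have hcauchy : CauchySeq s := by
    rw [cauchySeq_iff_tendsto_dist_atTop_0]
    have c1 := cauchySeq_iff_tendsto_dist_atTop_0.1 hh.cauchySeq
    have c2 := cauchySeq_iff_tendsto_dist_atTop_0.1 hu.cauchySeq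
    refine squeeze_zero (fun _ => dist_nonneg) (fun n => hdist n.1 n.2) ?_
    have c3 := c1.add (c2.div_const 2)
    rw [zero_div, add_zero] at c3
    exact c3
  obtain ⟨p, hp⟩ := cauchySeq_tendsto_of_complete hcauchy
  have hlap : Filter.Tendsto (fun n => laplacianL2 ⟨u n, h1 n⟩) Filter.atTop
      (nhds ((ν : ℂ)⁻¹ • p)) := by
    refine (hp.const_smul (ν : ℂ)⁻¹).congr fun n => ?_
    rw [hs, inv_smul_smul₀ hν']
  have htr : Filter.Tendsto t Filter.atTop (nhds (p - h')) :=
    (hp.sub hh).congr fun n => sub_sub_cancel _ _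
  have d1 := toDistr_eq_of_tendsto _ (fun n => toDistr_laplacianL2 ⟨u n, h1 n⟩) hu hlap
  have d2 := toDistr_eq_of_tendsto _ (fun n => toDistr_transportL2 ⟨u n, h2 n⟩) hu htr
  refine ⟨⟨_, d1⟩, ⟨_, d2⟩, ?_⟩
  have r1 : laplacianL2 ⟨u', ⟨_, d1⟩⟩ = (ν : ℂ)⁻¹ • p :=
    toDistr_injective ((toDistr_laplacianL2 _).trans d1.symm)
  have r2 : transportL2 ⟨u', ⟨_, d2⟩⟩ = p - h' :=
    toDistr_injective ((toDistr_transportL2 _).trans d2.symm)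
  rw [r1, r2, smul_inv_smul₀ hν', sub_sub_cancel]

theorem linearizedOp_apply (ν f : ℝ) (u : (linearizedOp ν f).domain) (i : Fin 3) :
    (linearizedOp ν f u) i = (ν : ℂ) • laplacianL2 ⟨u.1 i, (u.2 i).1⟩
      - transportL2 ⟨u.1 i, (u.2 i).2⟩ + ∑ j, coupling f i j (u.1 j) := rfl

theorem linearizedOp_isClosed {ν : ℝ} (hν : 0 < ν) (f : ℝ) : (linearizedOp ν f).IsClosed := by
  refine IsSeqClosed.isClosed fun x p hx hp => ?_
  choose U hU1 hU2 using fun n => (LinearPMap.mem_graph_iff _).1 (hx n)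
  have hproj (i : Fin 3) : Continuous fun v : L2Cubed => v i := PiLp.continuous_apply 2 _ i
  have hu : ∀ i, Filter.Tendsto (fun n => (U n).1 i) Filter.atTop (nhds (p.1 i)) := fun i =>
    (((hproj i).comp continuous_fst).tendsto p).comp hp |>.congr fun n => by
      simp [hU1]
  have hy : ∀ i, Filter.Tendsto (fun n => (linearizedOp ν f (U n)) i) Filter.atTop
      (nhds (p.2 i)) := fun i =>
    (((hproj i).comp continuous_snd).tendsto p).comp hp |>.congr fun n => by
      simp [hU2]
  have hC : ∀ i, Filter.Tendsto (fun n => ∑ j, coupling f i j ((U n).1 j)) Filter.atTop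
      (nhds (∑ j, coupling f i j (p.1 j))) := fun i =>
    tendsto_finsetSum _ fun j _ => ((coupling f i j).continuous.tendsto _).comp (hu j)
  have key : ∀ i, ∃ (h3 : p.1 i ∈ laplacianL2.domain) (h4 : p.1 i ∈ transportL2.domain),
      (ν : ℂ) • laplacianL2 ⟨p.1 i, h3⟩ - transportL2 ⟨p.1 i, h4⟩ =
        p.2 i - ∑ j, coupling f i j (p.1 j) := by
    intro i
    refine exists_of_tendsto_viscous_transport hν (fun n => ((U n).2 i).1)
      (fun n => ((U n).2 i).2) (hu i) (((hy i).sub (hC i)).congr fun n => ?_)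
    rw [linearizedOp_apply, add_sub_cancel_right]
  choose h3 h4 h5 using key
  refine (LinearPMap.mem_graph_iff _).2 ⟨⟨p.1, fun i => ⟨h3 i, h4 i⟩⟩, rfl, PiLp.ext fun i => ?_⟩
  rw [linearizedOp_apply]
  change (ν : ℂ) • laplacianL2 ⟨p.1 i, h3 i⟩ - transportL2 ⟨p.1 i, h4 i⟩ +
    ∑ j, coupling f i j (p.1 j) = p.2 i
  rw [h5, sub_add_cancel]

/-! ### Density of the domain -/

/-- Vector fields with Schwartz components. -/
def schwartzField (χ : Fin 3 → 𝓢(Space, ℂ)) : L2Cubed := WithLp.toLp 2 fun i => toL2 (χ i)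

theorem schwartzField_mem (ν f : ℝ) (χ : Fin 3 → 𝓢(Space, ℂ)) :
    schwartzField χ ∈ (linearizedOp ν f).domain :=
  fun i => ⟨toL2_mem_laplacianL2_domain (χ i), toL2_mem_transportL2_domain (χ i)⟩

theorem linearizedOp_schwartzField (ν f : ℝ) (χ : Fin 3 → 𝓢(Space, ℂ)) (i : Fin 3) :
    (linearizedOp ν f ⟨schwartzField χ, schwartzField_mem ν f χ⟩) i =
      (ν : ℂ) • toL2 (Δ (χ i)) - toL2 (coordMul 1 (coordDeriv 0 (χ i))) +
        ∑ j, coupling f i j (toL2 (χ j)) := by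
  rw [← laplacianL2_toL2, ← transportL2_toL2]
  rfl

theorem dense_linearizedOp_domain (ν f : ℝ) :
    Dense ((linearizedOp ν f).domain : Set L2Cubed) := by
  have h1 : DenseRange toL2 :=
    SchwartzMap.denseRange_toLpCLM (E := Space) (F := ℂ) (p := 2) (μ := volume)
      ENNReal.ofNat_ne_top
  have h2 : DenseRange (Pi.map fun _ : Fin 3 => toL2) := DenseRange.piMap fun _ => h1
  have h3 : DenseRange schwartzField :=
    (WithLp.toLp_surjective 2).denseRange.comp h2 (PiLp.continuous_toLp 2 _)
  refine h3.mono ?_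
  rintro _ ⟨χ, rfl⟩
  exact schwartzField_mem ν f χ

/-! ### Pointwise bounds for the coupling terms -/

/-- A bounded operator is pointwise bounded on the Fourier side. -/
def FourierBounded (B : L2 →L[ℂ] L2) : Prop :=
  ∃ K : ℝ, 0 ≤ K ∧ ∀ u : L2, ∀ᵐ ξ, ‖(𝓕 (B u) : L2) ξ‖ ≤ K * ‖(𝓕 u : L2) ξ‖

theorem FourierBounded.add {B C : L2 →L[ℂ] L2} (hB : FourierBounded B) (hC : FourierBounded C) :
    FourierBounded (B + C) := by
  obtain ⟨K, hK, h⟩ := hB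
  obtain ⟨M, hM, h'⟩ := hC
  refine ⟨K + M, add_nonneg hK hM, fun u => ?_⟩
  rw [add_apply, FourierTransform.fourier_add]
  filter_upwards [h u, h' u, Lp.coeFn_add (𝓕 (B u) : L2) (𝓕 (C u) : L2)] with ξ h1 h2 h3
  rw [h3, Pi.add_apply, add_mul]
  exact (norm_add_le _ _).trans (add_le_add h1 h2)

theorem FourierBounded.smul {B : L2 →L[ℂ] L2} (hB : FourierBounded B) (c : ℂ) :
    FourierBounded (c • B) := by
  obtain ⟨K, hK, h⟩ := hB
  refine ⟨‖c‖ * K, by positivity, fun u => ?_⟩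
  rw [smul_apply, FourierTransform.fourier_smul]
  filter_upwards [h u, Lp.coeFn_smul c (𝓕 (B u) : L2)] with ξ h1 h2
  rw [h2, Pi.smul_apply, norm_smul, mul_assoc]
  gcongr

theorem fourierBounded_one : FourierBounded 1 :=
  ⟨1, zero_le_one, fun u => Filter.Eventually.of_forall fun ξ => by simp⟩

theorem fourierBounded_riesz (i j : Fin 3) : FourierBounded (riesz i j) := by
  refine ⟨1, zero_le_one, fun u => ?_⟩
  filter_upwards [fourier_riesz i j u] with ξ h
  rw [h, norm_mul]
  gcongr
  have hi : |ξ i| ≤ ‖ξ‖ := PiLp.norm_apply_le ξ i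
  have hj : |ξ j| ≤ ‖ξ‖ := PiLp.norm_apply_le ξ j
  rw [rieszSymbol, Complex.norm_real, Real.norm_eq_abs, abs_div, abs_mul, abs_pow, abs_norm]
  refine div_le_one_of_le₀ ?_ (by positivity)
  rw [pow_two]
  exact mul_le_mul hi hj (abs_nonneg _) (norm_nonneg _)

/-- The symbol is real. -/
theorem riesz_adjoint (i j : Fin 3) : (riesz i j).adjoint = riesz i j := by
  symm
  rw [ContinuousLinearMap.eq_adjoint_iff]
  intro u v
  rw [← Lp.inner_fourier_eq, ← Lp.inner_fourier_eq u, L2_inner_eq, L2_inner_eq]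
  refine integral_congr_ae ?_
  filter_upwards [fourier_riesz i j u, fourier_riesz i j v] with ξ h1 h2
  have h3 : star (rieszSymbol i j ξ) = rieszSymbol i j ξ := Complex.conj_ofReal _
  rw [h1, h2, star_mul', h3]
  ring

theorem coupling_eq (f : ℝ) (i j : Fin 3) : ∃ (a b : ℂ) (k l : Fin 3),
    coupling f i j = a • (1 : L2 →L[ℂ] L2) + b • riesz k l := by
  fin_cases i <;> fin_cases j
  · exact ⟨0, f, 0, 1, by simp [coupling]⟩
  · exact ⟨f - 1, 2 - f, 0, 0, by simp [coupling]⟩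
  · exact ⟨0, 0, 0, 0, by simp [coupling]⟩
  · exact ⟨-f, f, 1, 1, by simp [coupling]⟩
  · exact ⟨0, 2 - f, 0, 1, by simp [coupling]⟩
  · exact ⟨0, 0, 0, 0, by simp [coupling]⟩
  · exact ⟨0, f, 1, 2, by simp [coupling]⟩
  · exact ⟨0, 2 - f, 0, 2, by simp [coupling]⟩
  · exact ⟨0, 0, 0, 0, by simp [coupling]⟩

theorem fourierBounded_coupling (f : ℝ) (i j : Fin 3) : FourierBounded (coupling f i j) := by
  obtain ⟨a, b, k, l, h⟩ := coupling_eq f i j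
  rw [h]
  exact (fourierBounded_one.smul a).add ((fourierBounded_riesz k l).smul b)

theorem fourierBounded_coupling_adjoint (f : ℝ) (i j : Fin 3) :
    FourierBounded (coupling f i j).adjoint := by
  obtain ⟨a, b, k, l, h⟩ := coupling_eq f i j
  have h1 : (1 : L2 →L[ℂ] L2).adjoint = 1 := ContinuousLinearMap.adjoint_id
  rw [h, map_add, map_smulₛₗ, map_smulₛₗ, riesz_adjoint, h1]
  exact (fourierBounded_one.smul _).add ((fourierBounded_riesz k l).smul _)

theorem exists_bound_sum_sub_smul {M : Fin 3 → Fin 3 → (L2 →L[ℂ] L2)}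
    (hM : ∀ i j, FourierBounded (M i j)) (lam : ℂ) :
    ∃ K : ℝ, 0 ≤ K ∧ ∀ (u : Fin 3 → L2) (i : Fin 3),
      ∀ᵐ ξ, ‖(𝓕 (lam • u i - ∑ j, M i j (u j)) : L2) ξ‖ ≤ K * ∑ j, ‖(𝓕 (u j) : L2) ξ‖ := by
  choose K hK h using hM
  have hKs : 0 ≤ ∑ i, ∑ j, K i j := Finset.sum_nonneg fun i _ => Finset.sum_nonneg fun j _ => hK i j
  refine ⟨‖lam‖ + ∑ i, ∑ j, K i j, by positivity, fun u i => ?_⟩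
  have e : (𝓕 (lam • u i - ∑ j, M i j (u j)) : L2) =
      lam • 𝓕 (u i) - (𝓕 (M i 0 (u 0)) + 𝓕 (M i 1 (u 1)) + 𝓕 (M i 2 (u 2))) := by
    rw [fourier_sub_L2, FourierTransform.fourier_smul, Fin.sum_univ_three,
      FourierTransform.fourier_add, FourierTransform.fourier_add]
  rw [e]
  have hle : ∀ j, K i j ≤ ∑ i, ∑ j, K i j := fun j =>
    (Finset.single_le_sum (f := K i) (fun j _ => hK i j) (Finset.mem_univ j)).trans
      (Finset.single_le_sum (f := fun i => ∑ j, K i j)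
        (fun i _ => Finset.sum_nonneg fun j _ => hK i j) (Finset.mem_univ i))
  filter_upwards [h i 0 (u 0), h i 1 (u 1), h i 2 (u 2),
    Lp.coeFn_sub (lam • 𝓕 (u i) : L2) (𝓕 (M i 0 (u 0)) + 𝓕 (M i 1 (u 1)) + 𝓕 (M i 2 (u 2))),
    Lp.coeFn_smul lam (𝓕 (u i) : L2),
    Lp.coeFn_add (𝓕 (M i 0 (u 0)) + 𝓕 (M i 1 (u 1)) : L2) (𝓕 (M i 2 (u 2))),
    Lp.coeFn_add (𝓕 (M i 0 (u 0)) : L2) (𝓕 (M i 1 (u 1)))] with ξ h0 h1 h2 h3 h4 h5 h6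
  rw [h3, Pi.sub_apply, h4, Pi.smul_apply, h5, Pi.add_apply, h6, Pi.add_apply, smul_eq_mul]
  have hi : ‖(𝓕 (u i) : L2) ξ‖ ≤ ∑ j, ‖(𝓕 (u j) : L2) ξ‖ :=
    Finset.single_le_sum (f := fun j => ‖(𝓕 (u j) : L2) ξ‖) (fun j _ => norm_nonneg _)
      (Finset.mem_univ i)
  have hstep : ∀ j, K i j * ‖(𝓕 (u j) : L2) ξ‖ ≤ (∑ i, ∑ j, K i j) * ‖(𝓕 (u j) : L2) ξ‖ :=
    fun j => mul_le_mul_of_nonneg_right (hle j) (norm_nonneg _)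
  refine (norm_sub_le _ _).trans ?_
  rw [add_mul, norm_mul]
  refine add_le_add (mul_le_mul_of_nonneg_left hi (norm_nonneg _)) ?_
  refine (norm_add₃_le).trans ?_
  rw [Fin.sum_univ_three (f := fun j => ‖(𝓕 (u j) : L2) ξ‖), mul_add, mul_add]
  exact add_le_add (add_le_add (h0.trans (hstep 0)) (h1.trans (hstep 1))) (h2.trans (hstep 2))

/-! ### Absence of eigenvalues -/

theorem L2Cubed_eq_zero {v : L2Cubed} (h : ∀ i, (𝓕 (v i) : L2) = 0) : v = 0 := by
  refine PiLp.ext fun i => ?_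
  exact (Lp.fourierTransformₗᵢ Space ℂ).map_eq_zero_iff.1 (h i)

theorem pointSpectrum_linearizedOp {ν : ℝ} (hν : 0 < ν) (f : ℝ) :
    pointSpectrum (linearizedOp ν f) = ∅ := by
  rw [Set.eq_empty_iff_forall_notMem]
  rintro lam ⟨u, hne, hu⟩
  have hc : 0 < 4 * Real.pi ^ 2 * ν := by positivity
  obtain ⟨K, hK, hb⟩ := exists_bound_sum_sub_smul (fourierBounded_coupling f) lam
  refine hne (Subtype.ext (L2Cubed_eq_zero fun i => ?_))
  refine eq_zero_of_hasWeakShearDeriv hc hK (one_pow 2 : (1 : ℝ) ^ 2 = 1)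
    (w := fun i => 𝓕 (u.1 i)) (hb fun j => u.1 j) (fun i => ?_) i
  have hi := congrArg (fun v : L2Cubed => v i) hu
  simp only [linearizedOp_apply, PiLp.smul_apply] at hi
  refine (hasWeakShearDeriv_fourier_transportL2 ⟨u.1 i, (u.2 i).2⟩).congr
    Filter.EventuallyEq.rfl ?_
  -- The eigenvalue equation solved for the shear derivative: the uniqueness system with `σ = 1` and
  -- `b` the transform of `λu` minus the coupling.
  have e : (-𝓕 (transportL2 ⟨u.1 i, (u.2 i).2⟩) : L2) =
      𝓕 (lam • u.1 i - ∑ j, coupling f i j (u.1 j)) -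
        (ν : ℂ) • 𝓕 (laplacianL2 ⟨u.1 i, (u.2 i).1⟩) := by
    rw [← hi, add_sub_cancel_right, fourier_sub_L2, FourierTransform.fourier_smul]
    abel
  rw [e]
  filter_upwards [fourier_laplacianL2 ⟨u.1 i, (u.2 i).1⟩,
    Lp.coeFn_sub (𝓕 (lam • u.1 i - ∑ j, coupling f i j (u.1 j)) : L2)
      ((ν : ℂ) • 𝓕 (laplacianL2 ⟨u.1 i, (u.2 i).1⟩)),
    Lp.coeFn_smul (ν : ℂ) (𝓕 (laplacianL2 ⟨u.1 i, (u.2 i).1⟩) : L2)] with ξ h1 h2 h3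
  rw [h2, Pi.sub_apply, h3, Pi.smul_apply, h1, smul_eq_mul]
  push_cast
  ring

/-- The domain of the adjoint need not be identified: testing with Schwartz fields having only an
`i`-th component already yields the adjoint equation weakly, with the coupling matrix transposed. -/
theorem inner_schwartz_of_adjoint_eq {ν f : ℝ} {mu : ℂ} {v : (linearizedOp ν f).adjoint.domain}
    (hv : (linearizedOp ν f).adjoint v = mu • (v : L2Cubed)) (i : Fin 3) (χ : 𝓢(Space, ℂ)) :
    inner ℂ (v.1 i) ((ν : ℂ) • toL2 (Δ χ) - toL2 (coordMul 1 (coordDeriv 0 χ))) =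
      inner ℂ (mu • v.1 i - ∑ j, (coupling f j i).adjoint (v.1 j)) (toL2 χ) := by
  set χs : Fin 3 → 𝓢(Space, ℂ) := Pi.single i χ with hχ
  have h := LinearPMap.adjoint_isFormalAdjoint (dense_linearizedOp_domain ν f) v
    ⟨schwartzField χs, schwartzField_mem ν f χs⟩
  rw [hv, PiLp.inner_apply, PiLp.inner_apply] at h
  have hne : ∀ k, k ≠ i → χs k = 0 := fun k hk => by rw [hχ, Pi.single_eq_of_ne hk]
  have hself : χs i = χ := by rw [hχ, Pi.single_eq_same]
  have hz : toL2 0 = 0 := (SchwartzMap.toLpCLM ℂ ℂ 2 (volume : Measure Space)).map_zero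
  have hlap : Δ (0 : 𝓢(Space, ℂ)) = 0 := by
    rw [← SchwartzMap.laplacianCLM_eq', map_zero]
  have hl : ∀ k, (schwartzField χs) k = toL2 (χs k) := fun k => rfl
  have e1 : ∑ k, inner ℂ ((mu • (v : L2Cubed)) k) ((schwartzField χs) k) =
      inner ℂ (mu • v.1 i) (toL2 χ) := by
    rw [Finset.sum_eq_single i (fun k _ hk => by rw [hl, hne k hk, hz, inner_zero_right])
      (fun h => absurd (Finset.mem_univ i) h), hl, hself]
    rfl
  have e2 : ∑ k, inner ℂ ((v : L2Cubed) k)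
      ((linearizedOp ν f ⟨schwartzField χs, schwartzField_mem ν f χs⟩) k) =
      inner ℂ (v.1 i) ((ν : ℂ) • toL2 (Δ χ) - toL2 (coordMul 1 (coordDeriv 0 χ))) +
        ∑ k, inner ℂ ((coupling f k i).adjoint (v.1 k)) (toL2 χ) := by
    simp only [linearizedOp_schwartzField, inner_add_right, Finset.sum_add_distrib]
    congr 1
    · rw [Finset.sum_eq_single i (fun k _ hk => by
        rw [hne k hk, map_zero, map_zero, hlap, hz, smul_zero, sub_zero, inner_zero_right])
        (fun h => absurd (Finset.mem_univ i) h), hself]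
    · refine Finset.sum_congr rfl fun k _ => ?_
      rw [Finset.sum_eq_single i (fun j _ hj => by rw [hne j hj, hz, map_zero])
        (fun h => absurd (Finset.mem_univ i) h), hself, ContinuousLinearMap.adjoint_inner_left]
  change ∑ k, inner ℂ ((mu • (v : L2Cubed)) k) ((schwartzField χs) k) = _ at h
  rw [e1, e2] at h
  rw [inner_sub_left, h, sum_inner, add_sub_cancel_right]

theorem shearDeriv_star {φ : Space → ℂ} (hφ : Differentiable ℝ φ) (ξ : Space) :
    shearDeriv (fun η => star (φ η)) ξ = star (shearDeriv φ ξ) := by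
  have h1 := hasDerivAt_comp_shear hφ ξ 0
  have h2 := hasDerivAt_comp_shear (Complex.conjCLE.differentiable.comp hφ) ξ 0
  have h3 := Complex.conjCLE.toContinuousLinearMap.hasFDerivAt.comp_hasDerivAt (0 : ℝ) h1
  rw [shear_zero] at h2 h3
  exact h2.unique h3

/-- Transposition reverses the sign of `D` but not of the viscous term, which yields the uniqueness
system with `σ = -1`. -/
theorem hasWeakShearDeriv_of_inner_schwartz {ν : ℝ} {v z : L2}
    (h : ∀ χ : 𝓢(Space, ℂ), inner ℂ v ((ν : ℂ) • toL2 (Δ χ) - toL2 (coordMul 1 (coordDeriv 0 χ))) =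
      inner ℂ z (toL2 χ)) :
    HasWeakShearDeriv (𝓕 v : L2) fun ξ => ((-1 : ℝ) : ℂ) *
      (((4 * Real.pi ^ 2 * ν * ‖ξ‖ ^ 2 : ℝ) : ℂ) * (𝓕 v : L2) ξ + (𝓕 z : L2) ξ) := by
  intro φ hφ hc
  obtain ⟨hφ', hc'⟩ := star_test hφ hc
  -- The inner product conjugates one argument while the weak derivative is bilinear; the test
  -- function is conjugated to compensate.
  set ψ : 𝓢(Space, ℂ) := hc'.toSchwartzMap hφ' with hψ
  have hψφ : ∀ ξ, ψ ξ = star (φ ξ) := fun ξ => rfl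
  have h1 := congrArg (starRingEnd ℂ) (h (𝓕⁻ ψ))
  rw [inner_conj_symm, inner_conj_symm, ← Lp.inner_fourier_eq, ← Lp.inner_fourier_eq (toL2 _),
    fourier_sub_L2, FourierTransform.fourier_smul, L2_inner_eq, L2_inner_eq] at h1
  have hF : (𝓕 (toL2 (𝓕⁻ ψ)) : L2) = toL2 ψ := by
    rw [SchwartzMap.toLp_fourier_eq, FourierTransform.fourier_fourierInv_eq]
  have hT : (𝓕 (toL2 (coordMul 1 (coordDeriv 0 (𝓕⁻ ψ)))) : L2) =
      toL2 (-coordMul 0 (coordDeriv 1 ψ)) := by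
    rw [SchwartzMap.toLp_fourier_eq, fourier_coordMul_coordDeriv,
      FourierTransform.fourier_fourierInv_eq]
  have hL := fourier_laplacianL2 ⟨toL2 (𝓕⁻ ψ), toL2_mem_laplacianL2_domain _⟩
  rw [laplacianL2_toL2] at hL
  rw [hF] at hL h1
  rw [hT] at h1
  have hstarD : ∀ ξ, star (shearDeriv ψ ξ) = shearDeriv φ ξ := fun ξ => by
    have : (ψ : Space → ℂ) = fun η => star (φ η) := rfl
    rw [this, shearDeriv_star (hφ.differentiable (by simp)), star_star]
  have e1 : ∫ ξ, (𝓕 z : L2) ξ * star (toL2 ψ ξ) = ∫ ξ, (𝓕 z : L2) ξ * φ ξ := by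
    refine integral_congr_ae ?_
    filter_upwards [SchwartzMap.coeFn_toLp ψ 2 volume] with ξ k1
    rw [k1, hψφ, star_star]
  have e2 : ∫ ξ, (𝓕 v : L2) ξ * star (((ν : ℂ) • 𝓕 (toL2 (Δ (𝓕⁻ ψ))) -
      toL2 (-coordMul 0 (coordDeriv 1 ψ)) : L2) ξ) =
      ∫ ξ, ((𝓕 v : L2) ξ * shearDeriv φ ξ -
        (𝓕 v : L2) ξ * (((4 * Real.pi ^ 2 * ν * ‖ξ‖ ^ 2 : ℝ) : ℂ) * φ ξ)) := by
    refine integral_congr_ae ?_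
    filter_upwards [SchwartzMap.coeFn_toLp ψ 2 volume, hL,
      SchwartzMap.coeFn_toLp (-coordMul 0 (coordDeriv 1 ψ)) 2 volume,
      Lp.coeFn_sub ((ν : ℂ) • 𝓕 (toL2 (Δ (𝓕⁻ ψ))) : L2) (toL2 (-coordMul 0 (coordDeriv 1 ψ))),
      Lp.coeFn_smul (ν : ℂ) (𝓕 (toL2 (Δ (𝓕⁻ ψ))) : L2)] with ξ k1 k2 k3 k4 k5
    have hr (r : ℝ) : star (r : ℂ) = r := Complex.conj_ofReal r
    rw [k4, Pi.sub_apply, k5, Pi.smul_apply, k2, k3, k1, neg_apply, coordMul_coordDeriv_apply,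
      star_sub, star_neg, hstarD, hψφ, smul_eq_mul, star_mul', star_mul', star_neg, hr, hr,
      star_star]
    push_cast
    ring
  have i1 := integrable_mul_test (locallyIntegrable_L2 (𝓕 v)) (continuous_shearDeriv hφ)
    (hasCompactSupport_shearDeriv hc)
  have i2 : Integrable fun ξ =>
      (𝓕 v : L2) ξ * (((4 * Real.pi ^ 2 * ν * ‖ξ‖ ^ 2 : ℝ) : ℂ) * φ ξ) :=
    integrable_mul_test (locallyIntegrable_L2 (𝓕 v))
      ((show Continuous fun ξ : Space => ((4 * Real.pi ^ 2 * ν * ‖ξ‖ ^ 2 : ℝ) : ℂ) by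
        fun_prop).mul hφ.continuous) hc.mul_left
  have i3 := integrable_mul_test (locallyIntegrable_L2 (𝓕 z)) hφ.continuous hc
  rw [e1, e2, integral_sub i1 i2, sub_eq_iff_eq_add, ← integral_add i3 i2] at h1
  rw [h1, ← integral_neg]
  refine integral_congr_ae (Filter.Eventually.of_forall fun ξ => ?_)
  simp only [Complex.ofReal_neg, Complex.ofReal_one]
  ring

theorem pointSpectrum_linearizedOp_adjoint {ν : ℝ} (hν : 0 < ν) (f : ℝ) :
    pointSpectrum (linearizedOp ν f).adjoint = ∅ := by
  rw [Set.eq_empty_iff_forall_notMem]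
  rintro mu ⟨v, hne, hv⟩
  have hc : 0 < 4 * Real.pi ^ 2 * ν := by positivity
  obtain ⟨K, hK, hb⟩ :=
    exists_bound_sum_sub_smul (fun i j => fourierBounded_coupling_adjoint f j i) mu
  refine hne (Subtype.ext (L2Cubed_eq_zero fun i => ?_))
  exact eq_zero_of_hasWeakShearDeriv hc hK (by norm_num : (-1 : ℝ) ^ 2 = 1)
    (w := fun i => 𝓕 (v.1 i)) (hb fun j => v.1 j)
    (fun i => hasWeakShearDeriv_of_inner_schwartz (inner_schwartz_of_adjoint_eq hv i)) i

end InertialInstability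

end

theorem mainTheorem6 (ν f : ℝ) (hν : 0 < ν) :
    Dense ((InertialInstability.linearizedOp ν f).domain : Set InertialInstability.L2Cubed) ∧
    (InertialInstability.linearizedOp ν f).IsClosed ∧
    InertialInstability.spectrumOf (InertialInstability.linearizedOp ν f) =
      InertialInstability.continuousSpectrum (InertialInstability.linearizedOp ν f) ∧
    InertialInstability.pointSpectrum (InertialInstability.linearizedOp ν f) = ∅ ∧
    InertialInstability.pointSpectrum (InertialInstability.linearizedOp ν f).adjoint = ∅ := by
  have h1 := InertialInstability.dense_linearizedOp_domain ν f
  have h2 := InertialInstability.linearizedOp_isClosed hν f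
  have h3 := InertialInstability.pointSpectrum_linearizedOp hν f
  have h4 := InertialInstability.pointSpectrum_linearizedOp_adjoint hν f
  exact ⟨h1, h2, InertialInstability.spectrumOf_eq_continuousSpectrum h1 h2 h3 h4, h3, h4⟩
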